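/- Let $\mathcal S=\{1,\dots,s\}$, let $\mathscr X_1,\dots,\mathscr X_s$ be finite sets, $\mathscr X=\prod_t \mathscr X_t$, and let $g:\mathscr X\to\mathscr Y$ be an arbitrary function. Let $X^{(n)}=(X_1^{(n)},\dots,X_s^{(n)})$, $n\ge 1$, be a homogeneous irreducible Markov chain with state space $\mathscr X$, arbitrary initial distribution and transition matrix $\mathbf P_0=c_1\mathbf U+(1-c_1)\mathbf 1$, where $0\le c_1\le 1$, $\mathbf 1$ is the identity matrix and all rows of $\mathbf U$ equal one vector $(u_x)_{x\in\mathscr X}$ with $\sum_x u_x=1$. A rate tuple $(R_1,\dots,R_s)\in\mathbb R^s$ belongs to the achievable region $\mathcal R[g]$ if for every $\epsilon>0$ there is $N_0$ such that for all $n>N_0$ there are encoders $\phi_t:\mathscr X_t^n\to[1,2^{nR_t}]\cap\mathbb N$ ($t\in\mathcal S$) and a decoder $\psi:\prod_t([1,2^{nR_t}]\cap\mathbb N)\to\mathscr Y^n$ with $$\Pr\Big\{\big(g(X^{(1)}),\dots,g(X^{(n)})\big)\ne\psi\big(\phi_1(X_1^n),\dots,\phi_s(X_s^n)\big)\Big\}<\epsilon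 ,\qquad X_t^n=(X_t^{(1)},\dots,X_t^{(n)}).$$ Then: 1. There exist a finite ring $\mathfrak R$ (with $1\neq 0$, not necessarily commutative) and functions $k_t:\mathscr X_t\to\mathfrak R$ and $h:\mathfrak R\to\mathscr Y$ such that $$g(x_1,\dots,x_s)=h\Big(\sum_{t=1}^s k_t(x_t)\Big)\quad\text{for all }(x_1,\dots,x_s)\in\mathscr X \qquad (*)$$ and $Z^{(n)}=\sum_{t=1}^s k_t(X_t^{(n)})$ is a homogeneous irreducible Markov chain on the state space $\mathscr Z=\{\sum_t k_t(x_t): x\in\mathscr X\}\subseteq\mathfrak R$; this chain has an invariant distribution. 2. Let $\mathfrak R$ (finite, $1\ne0$), $k_t$, $h$ be any choice satisfying $(*)$ for which $Z^{(n)}$ is a homogeneous irreducible Markov chain on $\mathscr Z$, with transition matrix $\mathbf P$ and invariant distribution $\pi$. For a left ideal $\mathfrak I$ of $\mathfrak R$ put $Y^{(m)}_{\mathfrak R/\mathfrak I}=Z^{(m)}+\mathfrak I$. Then for every left ideal $\mathfrak I\neq 0$ the limit $\lim_{m\to\infty}H(Y^{(m)}_{\mathfrak R/\mathfrak I}\mid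 Y^{(m-1)}_{\mathfrak R/\mathfrak I})$ exists, and with $$R_0=\max_{0\ne\mathfrak I\le_l\mathfrak R}\frac{\log|\mathfrak R|}{\log|\mathfrak I|}\min\Big\{H(\mathbf S_{\mathfrak R/\mathfrak I}\mid\pi),\ H(\mathbf P\mid\pi)-\lim_{m\to\infty}H\big(Y^{(m)}_{\mathfrak R/\mathfrak I}\,\big|\,Y^{(m-1)}_{\mathfrak R/\mathfrak I}\big)\Big\}$$ one has $$\{[R,R,\dots,R]\in\mathbb R^s : R>R_0\}\subseteq\mathcal R[g].$$ Here the maximum is over the nonzero left ideals of $\mathfrak R$; logarithms and entropies are to base $2$; $H(\mathbf Q\mid\pi)=-\sum_{i,j}\pi_i q_{i,j}\log q_{i,j}$ for a stochastic matrix $\mathbf Q=(q_{i,j})$; and $\mathbf S_{\mathfrak R/\mathfrak I}$ is the block diagonal matrix whose blocks are the stochastic complements $\mathbf S_A=\mathbf P_{A,A}+\mathbf P_{A,A^c}(\mathbf 1-\mathbf P_{A^c,A^c})^{-1}\mathbf P_{A^c,A}$, where $A$ runs over the nonempty intersections of $\mathscr Z$ with the cosets of $\mathfrak I$ and $A^c=\mathscr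 Z\setminus A$. -/

import Mathlib

open MeasureTheory Filter Topology

noncomputable section

namespace MarkovCoding

/-! ### Markov chains -/

/-- `X 0, X 1, X 2, …` (standing for `X^{(1)}, X^{(2)}, X^{(3)}, …`) is a homogeneous Markov chain
with finite state space `S` and transition matrix `P`; the initial distribution is arbitrary. -/
structure IsMarkovChain {Ω : Type*} [MeasurableSpace Ω] (μ : Measure Ω)
    {S : Type*} [Fintype S] (X : ℕ → Ω → S) (P : Matrix S S ℝ) : Prop where
  measurable : ∀ (n : ℕ) (x : S), MeasurableSet (X n ⁻¹' {x})
  nonneg : ∀ i j, 0 ≤ P i j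
  row_sum : ∀ i, ∑ j, P i j = 1
  markov : ∀ (n : ℕ) (x : ℕ → S),
    μ.real {ω | ∀ i ≤ n + 1, X i ω = x i} =
      μ.real {ω | ∀ i ≤ n, X i ω = x i} * P (x n) (x (n + 1))

/-- A homogeneous Markov chain whose transition matrix `P` is irreducible. -/
def IsIrreducibleMarkovChain {Ω : Type*} [MeasurableSpace Ω] (μ : Measure Ω)
    {S : Type*} [Fintype S] (X : ℕ → Ω → S) (P : Matrix S S ℝ) : Prop :=
  IsMarkovChain μ X P ∧ P.IsIrreducible

/-- `π` is an invariant distribution of `P`. -/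
structure IsInvariantDistribution {S : Type*} [Fintype S] (π : S → ℝ) (P : Matrix S S ℝ) :
    Prop where
  nonneg : ∀ i, 0 ≤ π i
  sum_eq_one : ∑ i, π i = 1
  invariant : ∀ j, ∑ i, π i * P i j = π j

/-! ### Entropies (in bits) -/

/-- `H(P | π)`: the conditional entropy `H(Y | X)` for `X ∼ π` and `(X, Y) ∼ π P`. -/
def matrixEntropy {S : Type*} [Fintype S] (P : Matrix S S ℝ) (π : S → ℝ) : ℝ :=
  -∑ i, ∑ j, π i * P i j * Real.logb 2 (P i j)

/-- `H(V | U)` for random variables `U`, `V` with finite sample spaces. -/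
def condEntropy {Ω : Type*} [MeasurableSpace Ω] (μ : Measure Ω) {A B : Type*} [Fintype A]
    [Fintype B] (V : Ω → B) (U : Ω → A) : ℝ :=
  -∑ a, ∑ b, μ.real {ω | U ω = a ∧ V ω = b} *
    Real.logb 2 (μ.real {ω | U ω = a ∧ V ω = b} / μ.real {ω | U ω = a})

/-! ### Stochastic complements -/

open Classical in
/-- The stochastic complement `S_A = P_{A,A} + P_{A,Aᶜ} (1 - P_{Aᶜ,Aᶜ})⁻¹ P_{Aᶜ,A}`. -/
def stochasticComplement {S : Type*} [Fintype S] (P : Matrix S S ℝ) (A : S → Prop) :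
    Matrix {i // A i} {i // A i} ℝ :=
  P.toBlock A A + P.toBlock A (fun i => ¬ A i) *
    (1 - P.toBlock (fun i => ¬ A i) (fun i => ¬ A i))⁻¹ * P.toBlock (fun i => ¬ A i) A

open Classical in
/-- The block diagonal matrix `diag {S_A}`, where `A` runs over the classes of the partition
of `S` into the fibres of `c`. -/
def diagComplement {S Q : Type*} [Fintype S] (P : Matrix S S ℝ) (c : S → Q) : Matrix S S ℝ :=
  fun i j => if h : c j = c i then
    stochasticComplement P (fun z => c z = c i) ⟨i, rfl⟩ ⟨j, h⟩ else 0

/-! ### Computing a function of correlated sources -/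

/-- The index set `[1, 2^{n r}]` (integers) of a code of block length `n` and rate `r`. -/
abbrev MessageSet (n : ℕ) (r : ℝ) : Type :=
  {m : ℕ // 1 ≤ m ∧ (m : ℝ) ≤ (2 : ℝ) ^ ((n : ℝ) * r)}

/-- The achievable coding rate region for computing `g`. Here `X n ω t` is the symbol
produced by the `t`-th source. -/
def codingRegion {Ω : Type*} [MeasurableSpace Ω] (μ : Measure Ω) {s : ℕ}
    {𝒳 : Fin s → Type*} {𝒴 : Type*} (X : ℕ → Ω → (∀ t, 𝒳 t)) (g : (∀ t, 𝒳 t) → 𝒴) :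
    Set (Fin s → ℝ) :=
  {r | ∀ ε > (0 : ℝ), ∃ N₀ : ℕ, ∀ n > N₀,
    ∃ (φ : ∀ t, (Fin n → 𝒳 t) → MessageSet n (r t))
      (ψ : (∀ t, MessageSet n (r t)) → (Fin n → 𝒴)),
      μ.real {ω | (fun i : Fin n => g (X i ω)) ≠ ψ (fun t => φ t (fun i => X i ω t))} < ε}

/-! ### Presentations of functions over finite rings -/

/-- `g(x_1, …, x_s) = h (k_1(x_1) + ⋯ + k_s(x_s))`. -/
def IsPresentation {s : ℕ} {𝒳 : Fin s → Type*} {𝒴 : Type*} (g : (∀ t, 𝒳 t) → 𝒴)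
    {R : Type*} [Ring R] (k : ∀ t, 𝒳 t → R) (h : R → 𝒴) : Prop :=
  ∀ x, g x = h (∑ t, k t (x t))

/-- The set of values of `k_1(x_1) + ⋯ + k_s(x_s)`, the state space of the sum process. -/
def sumRange {s : ℕ} {𝒳 : Fin s → Type*} {R : Type*} [Ring R] (k : ∀ t, 𝒳 t → R) : Set R :=
  Set.range fun x : (∀ t, 𝒳 t) => ∑ t, k t (x t)

instance {s : ℕ} {𝒳 : Fin s → Type*} {R : Type*} [Ring R] [Fintype R] (k : ∀ t, 𝒳 t → R) :
    Fintype (sumRange k) := Fintype.ofFinite _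

/-- The process `Z^{(n)} = k_1(X_1^{(n)}) + ⋯ + k_s(X_s^{(n)})`. -/
def sumProcess {Ω : Type*} {s : ℕ} {𝒳 : Fin s → Type*} {R : Type*} [Ring R]
    (k : ∀ t, 𝒳 t → R) (X : ℕ → Ω → (∀ t, 𝒳 t)) (n : ℕ) (ω : Ω) : sumRange k :=
  ⟨∑ t, k t (X n ω t), X n ω, rfl⟩

/-- The coset `z + I` of a left ideal `I`, for `z` in a set `T` of ring elements. -/
def coset {R : Type*} [Ring R] {T : Set R} (I : Ideal R) (z : T) : R ⧸ I :=
  Submodule.Quotient.mk (z : R)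

/-- The rate bound
`max_{0 ≠ I ≤_l R} (log |R| / log |I|) * min {H(S_{R/I} | π), H(P | π) - L I}`,
the maximum over the (finitely many) nonzero left ideals; `S_{R/I}` is the block diagonal
matrix of the stochastic complements with respect to the cosets of `I`. -/
def rateBound {R : Type*} [Ring R] {T : Set R} [Fintype T] (P : Matrix T T ℝ) (π : T → ℝ)
    (L : Ideal R → ℝ) : ℝ :=
  ⨆ I : {I : Ideal R // I ≠ ⊥},
    Real.logb 2 (Nat.card R) / Real.logb 2 (Nat.card I.1) *
      min (matrixEntropy (diagComplement P (coset I.1)) π) (matrixEntropy P π - L I.1)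

end MarkovCoding

end

/-!
An irreducible matrix `c U + (1 - c) 1` describes a chain that renews itself: at each step it
draws a fresh state from the weights `u` with probability `c`, which can be taken positive, and
otherwise stays (`renewalMatrix`, `exists_eq_renewalMatrix`). Every
function of such a chain is again such a chain, with the image weights
(`IsMarkovChain.lump_renewalMatrix`). Hence the sum process of any presentation is a renewal chain
with positive weights `v`, its transition matrix is determined by the process
(`IsMarkovChain.eq_of_pos`), its only invariant distribution is `v`, and its process of cosets
modulo a left ideal `I` is a renewal chain too, whose conditional entropies converge to its
entropy rate `L I` (`IsMarkovChain.tendsto_condEntropy`). A presentation exists because a sum in a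
power of `ZMod N` can record all its arguments (`exists_presentation`).

The stochastic complement of a renewal chain is the renewal chain for the conditioned weights
(`stochasticComplement_renewalMatrix`). Its rows are mixtures of a direct return and of a fresh
draw, so by concavity of entropy the minimum in the rate bound is always `H(P | π) - L I`
(`matrixEntropy_sub_le_diagComplement`), and it suffices to achieve every rate `r` such that
`r log |I| / log |R| > H(P | π) - L I` for each `I ≠ 0`.

All encoders multiply the ring images of their blocks by one matrix `A` with `K ≈ n r / log |R|`
rows and the decoder looks for a typical word with the sum of the messages as its syndrome. A word
is typical if the transition probabilities of the word and of its coset words have the exponents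
`H(P | π)` and `L I`; by a weak law of large numbers (`IsMarkovChain.tendsto_transSum`) the block
is typical with high probability. At most about `2 ^ (n (H(P | π) - L I))` typical words agree
with a given one modulo `I` (`card_typical_fiber_le`). If the entries of the difference `d` of two
words generate the left ideal `I`, then a uniform `A` satisfies `A d = 0` with probability
`|I| ^ (-K)` (`card_mulVec_eq_zero`), so the union bound over `I` shows that some `A` is good
(`exists_matrix_error_le`).
-/

namespace MarkovCoding

/-! ### Path laws of Markov chains and lumping -/

section Paths

variable {Ω : Type*} [MeasurableSpace Ω] {μ : Measure Ω} {S : Type*}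

/-- The probability that the process `X` starts with the path `x` of `n` symbols. -/
noncomputable def pathLaw (μ : Measure Ω) (X : ℕ → Ω → S) (n : ℕ) (x : Fin n → S) : ℝ :=
  μ.real {ω | ∀ i : Fin n, X i ω = x i}

theorem pathLaw_nonneg (X : ℕ → Ω → S) (n : ℕ) (x : Fin n → S) : 0 ≤ pathLaw μ X n x :=
  measureReal_nonneg

variable [Fintype S] {X : ℕ → Ω → S} {P : Matrix S S ℝ}

theorem sum_snoc {M : Type*} [AddCommMonoid M] (n : ℕ) (F : (Fin (n + 1) → S) → M) :
    ∑ x, F x = ∑ x : Fin n → S, ∑ b : S, F (Fin.snoc x b) := by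
  rw [← Fintype.sum_prod_type_right', ← (Fin.snocEquiv fun _ : Fin (n + 1) => S).sum_comp]
  rfl

open Classical in
/-- Events about the first `n` symbols are finite disjoint unions of path events. -/
theorem measureReal_path [IsFiniteMeasure μ] (hm : ∀ n x, MeasurableSet (X n ⁻¹' {x}))
    (n : ℕ) (p : (Fin n → S) → Prop) :
    μ.real {ω | p fun i => X i ω} = ∑ x : Fin n → S, pathLaw μ X n x * if p x then 1 else 0 := by
  simp only [mul_boole]
  rw [← Finset.sum_filter]
  have : {ω | p fun i => X i ω} =
      ⋃ x ∈ Finset.univ.filter p, {ω | ∀ i : Fin n, X i ω = x i} := by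
    ext ω
    simp only [Set.mem_ofPred_eq, Finset.mem_filter, Finset.mem_univ, true_and, Set.mem_iUnion,
      exists_prop]
    constructor
    · intro h
      exact ⟨_, h, fun _ => rfl⟩
    · rintro ⟨x, hx, h⟩
      rwa [funext h]
  rw [this, measureReal_biUnion_finset]
  · rfl
  · intro x _ y _ hxy
    refine Set.disjoint_left.2 fun ω hx hy => hxy (funext fun i => ?_)
    rw [← hx i, ← hy i]
  · intro x _
    rw [Set.ofPred_forall]
    exact MeasurableSet.iInter fun i => hm i (x i)

theorem sum_pathLaw [IsProbabilityMeasure μ] (hm : ∀ n x, MeasurableSet (X n ⁻¹' {x}))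
    (n : ℕ) : ∑ x, pathLaw μ X n x = 1 := by
  have := measureReal_path (μ := μ) hm n fun _ => True
  simpa using this.symm

theorem IsMarkovChain.pathLaw_snoc (hX : IsMarkovChain μ X P) (n : ℕ) (x : Fin (n + 1) → S)
    (b : S) : pathLaw μ X (n + 2) (Fin.snoc x b) =
      pathLaw μ X (n + 1) x * P (x (Fin.last n)) b := by
  have h := hX.markov n fun i => if hi : i < n + 1 then x ⟨i, hi⟩ else b
  simp only [lt_add_iff_pos_right, zero_lt_one, dite_true, lt_irrefl, dite_false] at h
  have e1 : {ω | ∀ i : Fin (n + 2), X i ω = (Fin.snoc x b : Fin (n + 2) → S) i} =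
      {ω | ∀ i ≤ n + 1, X i ω = if hi : i < n + 1 then x ⟨i, hi⟩ else b} := by
    ext ω
    rw [Set.mem_ofPred_eq, Set.mem_ofPred_eq, Fin.forall_fin_succ']
    constructor
    · rintro ⟨h1, h2⟩ i hi
      split_ifs with hi'
      · have := h1 ⟨i, hi'⟩
        rwa [Fin.snoc_castSucc] at this
      · obtain rfl : i = n + 1 := by omega
        simpa using h2
    · intro h
      refine ⟨fun i => ?_, ?_⟩
      · simpa [Fin.snoc] using h i (by omega)
      · simpa using h (n + 1) le_rfl
  have e2 : {ω | ∀ i : Fin (n + 1), X i ω = x i} =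
      {ω | ∀ i ≤ n, X i ω = if hi : i < n + 1 then x ⟨i, hi⟩ else b} := by
    ext ω
    rw [Set.mem_ofPred_eq, Set.mem_ofPred_eq]
    constructor
    · intro h i hi
      rw [dif_pos (by omega)]
      exact h ⟨i, by omega⟩
    · intro h i
      have := h i (by omega)
      rwa [dif_pos i.2] at this
  unfold pathLaw
  rw [e1, e2, h]
  rfl

/-- The Markov property for sums over paths. -/
theorem IsMarkovChain.sum_pathLaw_mul (hX : IsMarkovChain μ X P) (n : ℕ)
    (F : (Fin (n + 2) → S) → ℝ) : ∑ x, pathLaw μ X (n + 2) x * F x =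
      ∑ x : Fin (n + 1) → S, pathLaw μ X (n + 1) x *
        ∑ b, P (x (Fin.last n)) b * F (Fin.snoc x b) := by
  rw [sum_snoc]
  simp only [hX.pathLaw_snoc, Finset.mul_sum, mul_assoc]

open Classical in
theorem IsMarkovChain.measureReal_step [IsFiniteMeasure μ] (hX : IsMarkovChain μ X P) (n : ℕ)
    (a b : S) : μ.real {ω | X n ω = a ∧ X (n + 1) ω = b} = μ.real {ω | X n ω = a} * P a b := by
  have h1 := measureReal_path (μ := μ) hX.measurable (n + 2)
    fun x => x (Fin.last n).castSucc = a ∧ x (Fin.last (n + 1)) = b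
  have h2 := measureReal_path (μ := μ) hX.measurable (n + 1) fun x => x (Fin.last n) = a
  simp only [Fin.val_castSucc, Fin.val_last] at h1 h2
  rw [h1, h2, Finset.sum_mul]
  rw [hX.sum_pathLaw_mul]
  refine Finset.sum_congr rfl fun x _ => ?_
  rw [mul_assoc]
  congr 1
  simp only [Fin.snoc_castSucc, Fin.snoc_last, ite_and]
  by_cases h : x (Fin.last n) = a <;> simp [h]

open Classical in
/-- A function `f` of a Markov chain is a Markov chain if the probability of moving into a fibre
of `f` depends only on the fibre of the present state. -/
theorem IsMarkovChain.lump [IsFiniteMeasure μ] (hX : IsMarkovChain μ X P)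
    {T : Type*} [Fintype T] (f : S → T) {Q : Matrix T T ℝ}
    (hQ : ∀ i j, 0 ≤ Q i j) (hQ1 : ∀ i, ∑ j, Q i j = 1)
    (h : ∀ a q, (∑ b, if f b = q then P a b else 0) = Q (f a) q) :
    IsMarkovChain μ (fun n ω => f (X n ω)) Q where
  measurable n q := by
    have : (fun ω => f (X n ω)) ⁻¹' {q} = ⋃ x ∈ f ⁻¹' {q}, X n ⁻¹' {x} := by
      ext ω; simp
    rw [this]
    exact (Set.toFinite _).measurableSet_biUnion fun x _ => hX.measurable n x
  nonneg := hQ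
  row_sum := hQ1
  markov n y := by
    have h1 := measureReal_path (μ := μ) hX.measurable (n + 2)
      fun x => ∀ i, f (x i) = y i
    have h2 := measureReal_path (μ := μ) hX.measurable (n + 1)
      fun x => ∀ i, f (x i) = y i
    have e (m : ℕ) : {ω | ∀ i ≤ m, f (X i ω) = y i} =
        {ω | ∀ i : Fin (m + 1), f (X i ω) = y i} := by
      ext ω
      exact ⟨fun h i => h i (by omega), fun h i hi => h ⟨i, by omega⟩⟩
    rw [e, e, h1, h2, Finset.sum_mul]
    rw [hX.sum_pathLaw_mul]
    refine Finset.sum_congr rfl fun x _ => ?_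
    rw [mul_assoc]
    congr 1
    simp only [Fin.forall_fin_succ' (n := n + 1), Fin.snoc_castSucc, Fin.snoc_last,
      Fin.val_castSucc, Fin.val_last]
    by_cases hx : ∀ i : Fin (n + 1), f (x i) = y i
    · simp only [hx, implies_true, true_and, mul_boole, if_true, one_mul, h, Fin.val_last]
    · simp [hx]

/-- A Markov chain has at most one strictly positive transition matrix: every pair of states is
then visited at times `1` and `2` with positive probability. -/
theorem IsMarkovChain.eq_of_pos [IsProbabilityMeasure μ] {P' : Matrix S S ℝ}
    (hX : IsMarkovChain μ X P) (hX' : IsMarkovChain μ X P') (hP : ∀ i j, 0 < P i j) :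
    P' = P := by
  obtain ⟨x₀, hx₀⟩ : ∃ x : Fin 1 → S, 0 < pathLaw μ X 1 x := by
    by_contra! hcon
    have := sum_pathLaw (μ := μ) hX.measurable 1
    have h2 : ∑ x, pathLaw μ X 1 x ≤ 0 := Finset.sum_nonpos fun x _ => hcon x
    linarith
  ext i j
  have h1 := hX.pathLaw_snoc 0 x₀ i
  have hpos : 0 < pathLaw μ X 2 (Fin.snoc x₀ i) := h1 ▸ mul_pos hx₀ (hP _ _)
  have h2 := hX.pathLaw_snoc 1 (Fin.snoc x₀ i) j
  have h3 := hX'.pathLaw_snoc 1 (Fin.snoc x₀ i) j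
  rw [h2] at h3
  have := mul_left_cancel₀ hpos.ne' h3
  have e : (Fin.snoc x₀ i : Fin 2 → S) (Fin.last 1) = i := Fin.snoc_last (α := fun _ => S) ..
  rw [e] at this
  exact this.symm

end Paths

/-! ### Chains that renew or stay -/

section Renewal

variable {S : Type*}

open Classical in
/-- The transition matrix `c U + (1 - c) 1`, all rows of `U` being `v`: with probability `c` a
fresh state is drawn from `v`, otherwise the chain stays where it is. -/
noncomputable def renewalMatrix (c : ℝ) (v : S → ℝ) : Matrix S S ℝ :=
  fun i j => c * v j + (1 - c) * if i = j then 1 else 0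

open Classical in
/-- The image of the weights `v` under `f`. -/
noncomputable def pushWeight [Fintype S] {T : Type*} (f : S → T) (v : S → ℝ) : T → ℝ :=
  fun q => ∑ z, if f z = q then v z else 0

theorem renewalMatrix_nonneg {c : ℝ} {v : S → ℝ} (hc : 0 ≤ c) (hc1 : c ≤ 1)
    (hv : ∀ i, 0 ≤ v i) (i j : S) : 0 ≤ renewalMatrix c v i j := by
  unfold renewalMatrix
  have := mul_nonneg hc (hv j)
  split_ifs <;> linarith

theorem renewalMatrix_pos {c : ℝ} {v : S → ℝ} (hc : 0 < c) (hc1 : c ≤ 1)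
    (i : S) {j : S} (hv : 0 < v j) : 0 < renewalMatrix c v i j := by
  unfold renewalMatrix
  have := mul_pos hc hv
  split_ifs <;> linarith

variable [Fintype S]

/-- The action of a renewal matrix on functions. -/
theorem sum_renewalMatrix_mul (c : ℝ) (v : S → ℝ) (i : S) (F : S → ℝ) :
    ∑ j, renewalMatrix c v i j * F j = c * ∑ j, v j * F j + (1 - c) * F i := by
  classical
  simp [renewalMatrix, add_mul, Finset.sum_add_distrib, Finset.mul_sum, mul_assoc]

theorem sum_mul_renewalMatrix (c : ℝ) (v w : S → ℝ) (j : S) :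
    ∑ i, w i * renewalMatrix c v i j = c * (∑ i, w i) * v j + (1 - c) * w j := by
  classical
  simp [renewalMatrix, mul_add, Finset.sum_add_distrib, Finset.mul_sum,
    mul_comm, mul_left_comm]

theorem renewalMatrix_row_sum (c : ℝ) {v : S → ℝ} (hv1 : ∑ i, v i = 1) (i : S) :
    ∑ j, renewalMatrix c v i j = 1 := by
  have := sum_renewalMatrix_mul c v i fun _ => 1
  simp only [mul_one, hv1] at this
  rw [this]; ring

theorem pushWeight_nonneg {T : Type*} (f : S → T) {v : S → ℝ} (hv : ∀ i, 0 ≤ v i) (q : T) :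
    0 ≤ pushWeight f v q :=
  Finset.sum_nonneg fun i _ => by split_ifs <;> simp [hv]

theorem pushWeight_pos {T : Type*} (f : S → T) {v : S → ℝ} (hv : ∀ i, 0 < v i) (z : S) :
    0 < pushWeight f v (f z) :=
  Finset.sum_pos' (fun i _ => by split_ifs <;> simp [(hv _).le])
    ⟨z, Finset.mem_univ _, by simp [hv]⟩

theorem sum_pushWeight_mul {T : Type*} [Fintype T] (f : S → T) (v : S → ℝ) (F : T → ℝ) :
    ∑ q, pushWeight f v q * F q = ∑ z, v z * F (f z) := by
  classical
  simp only [pushWeight, Finset.sum_mul]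
  rw [Finset.sum_comm]
  simp

theorem sum_pushWeight {T : Type*} [Fintype T] (f : S → T) (v : S → ℝ) :
    ∑ q, pushWeight f v q = ∑ z, v z := by
  simpa using sum_pushWeight_mul f v fun _ => 1

open Classical in
theorem sum_renewalMatrix_fiber {T : Type*} (f : S → T) (c : ℝ) (v : S → ℝ) (a : S) (q : T) :
    (∑ b, if f b = q then renewalMatrix c v a b else 0) =
      renewalMatrix c (pushWeight f v) (f a) q := by
  have := sum_renewalMatrix_mul c v a fun b => if f b = q then 1 else 0
  simp only [mul_boole] at this
  rw [this, renewalMatrix, pushWeight, mul_boole]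

theorem sum_renewalMatrix_mul_comp {T : Type*} [Fintype T] (f : S → T) (c : ℝ) (v : S → ℝ)
    (a : S) (F : T → ℝ) :
    ∑ q, renewalMatrix c (pushWeight f v) (f a) q * F q =
      ∑ b, renewalMatrix c v a b * F (f b) := by
  rw [sum_renewalMatrix_mul, sum_renewalMatrix_mul c v a fun b => F (f b), sum_pushWeight_mul]

/-- The only invariant distribution of a renewal matrix is its vector of weights. -/
theorem IsInvariantDistribution.eq_weight {c : ℝ} {v π : S → ℝ} (hc : 0 < c)
    (h : IsInvariantDistribution π (renewalMatrix c v)) : π = v := by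
  funext j
  have := h.invariant j
  rw [sum_mul_renewalMatrix, h.sum_eq_one] at this
  have h2 : c * (π j - v j) = 0 := by linarith
  rcases mul_eq_zero.1 h2 with h2 | h2 <;> linarith

theorem isInvariantDistribution_renewalMatrix {c : ℝ} {v : S → ℝ} (hv : ∀ i, 0 ≤ v i)
    (hv1 : ∑ i, v i = 1) : IsInvariantDistribution v (renewalMatrix c v) where
  nonneg := hv
  sum_eq_one := hv1
  invariant j := by rw [sum_mul_renewalMatrix, hv1]; ring

theorem isIrreducible_of_pos {P : Matrix S S ℝ} (h : ∀ i j, 0 < P i j) : P.IsIrreducible := by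
  classical
  rw [Matrix.isIrreducible_iff_exists_pow_pos fun i j => (h i j).le]
  exact fun i j => ⟨1, one_pos, by simpa using h i j⟩

/-- An irreducible matrix `c U + (1 - c) 1` is a renewal matrix with positive weights. For a single
state the given `c` may vanish, and it is replaced by `1`. -/
theorem exists_eq_renewalMatrix [DecidableEq S] {c : ℝ} {u : S → ℝ} (hc₀ : 0 ≤ c)
    (hc₁ : c ≤ 1) (hu : ∑ x, u x = 1)
    (h : (c • Matrix.of (fun _ y => u y) + (1 - c) • (1 : Matrix S S ℝ)).IsIrreducible) :
    ∃ c' > 0, c' ≤ 1 ∧ (∀ x, 0 < u x) ∧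
      c • Matrix.of (fun _ y => u y) + (1 - c) • (1 : Matrix S S ℝ) = renewalMatrix c' u := by
  rcases subsingleton_or_nontrivial S with hS | hS
  · have hu' (x : S) : u x = 1 := by
      rw [← hu]; exact (Fintype.sum_subsingleton _ x).symm
    refine ⟨1, one_pos, le_rfl, fun x => by simp [hu'], ?_⟩
    ext i j
    obtain rfl := Subsingleton.elim i j
    simp [renewalMatrix, hu']
  · set M : Matrix S S ℝ := c • Matrix.of (fun _ y => u y) + (1 - c) • (1 : Matrix S S ℝ) with hM
    have he (i j : S) (hij : i ≠ j) : M i j = c * u j := by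
      simp [hM, Matrix.one_apply_ne hij]
    -- each state is entered from some other state
    have hpos (j : S) : 0 < c * u j := by
      have hn (j : S) : 0 ≤ c * u j := by
        obtain ⟨i, hi⟩ := exists_ne j
        rw [← he i j hi]
        exact h.nonneg i j
      refine (hn j).lt_of_ne' fun h0 => ?_
      obtain ⟨i, hi⟩ := exists_ne j
      obtain ⟨k, _, hk⟩ := (Matrix.isIrreducible_iff_exists_pow_pos h.nonneg).1 h i j
      have hz : ∀ k, (M ^ k) i j = 0 := by
        intro k
        induction k with
        | zero => simp [Matrix.one_apply_ne hi]
        | succ k ih =>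
          rw [pow_succ, Matrix.mul_apply]
          refine Finset.sum_eq_zero fun l _ => ?_
          by_cases hl : l = j
          · rw [hl, ih, zero_mul]
          · rw [he l j hl, h0, mul_zero]
      exact hk.ne' (hz k)
    obtain ⟨j⟩ : Nonempty S := inferInstance
    have hc : 0 < c := hc₀.lt_of_ne fun h0 => by simpa [← h0] using hpos j
    refine ⟨c, hc, hc₁, fun x => pos_of_mul_pos_right (hpos x) hc.le, ?_⟩
    ext i j
    simp [hM, renewalMatrix, Matrix.one_apply]

/-- A function of a renewal chain is a renewal chain. -/
theorem IsMarkovChain.lump_renewalMatrix {Ω : Type*} [MeasurableSpace Ω] {μ : Measure Ω}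
    [IsFiniteMeasure μ] {X : ℕ → Ω → S} {c : ℝ} {v : S → ℝ} (hc : 0 ≤ c) (hc1 : c ≤ 1)
    (hv : ∀ i, 0 ≤ v i) (hv1 : ∑ i, v i = 1) (hX : IsMarkovChain μ X (renewalMatrix c v))
    {T : Type*} [Fintype T] (f : S → T) :
    IsMarkovChain μ (fun n ω => f (X n ω)) (renewalMatrix c (pushWeight f v)) :=
  hX.lump f (renewalMatrix_nonneg hc hc1 (pushWeight_nonneg f hv))
    (renewalMatrix_row_sum c ((sum_pushWeight f v).trans hv1))
    (sum_renewalMatrix_fiber f c v)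

end Renewal

/-! ### A weak law of large numbers for transitions -/

section LargeNumbers

variable {S : Type*}

/-- The sum of `f` over the `n` transitions of a path of `n + 1` symbols. -/
def transSum (f : S → S → ℝ) (n : ℕ) (x : Fin (n + 1) → S) : ℝ :=
  ∑ i : Fin n, f (x i.castSucc) (x i.succ)

theorem transSum_snoc (f : S → S → ℝ) (n : ℕ) (x : Fin (n + 1) → S) (b : S) :
    transSum f (n + 1) (Fin.snoc x b) = transSum f n x + f (x (Fin.last n)) b := by
  unfold transSum
  rw [Fin.sum_univ_castSucc]
  simp only [Fin.snoc_castSucc, Fin.succ_last, Fin.snoc_last, Fin.succ_castSucc]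

theorem transSum_telescope (G : S → ℝ) (n : ℕ) (x : Fin (n + 1) → S) :
    transSum (fun a b => G b - G a) n x = G (x (Fin.last n)) - G (x 0) := by
  have h1 := Fin.sum_univ_succ fun i : Fin (n + 1) => G (x i)
  have h2 := Fin.sum_univ_castSucc fun i : Fin (n + 1) => G (x i)
  simp only [transSum, Finset.sum_sub_distrib]
  linarith

variable [Fintype S]

/-- The stationary mean of a function `f` of a transition. -/
def transMean (P : Matrix S S ℝ) (π : S → ℝ) (f : S → S → ℝ) : ℝ :=
  ∑ a, π a * ∑ b, P a b * f a b

variable {Ω : Type*} [MeasurableSpace Ω] {μ : Measure Ω} [IsProbabilityMeasure μ]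
  {X : ℕ → Ω → S}

/-- Functions of a transition with conditional mean zero are orthogonal martingale differences, so
the second moment of their sum grows at most linearly. -/
theorem IsMarkovChain.sum_sq_transSum_le {P : Matrix S S ℝ} (hX : IsMarkovChain μ X P)
    {D : S → S → ℝ} (hD : ∀ a, ∑ b, P a b * D a b = 0) {C : ℝ} (hC : ∀ a b, |D a b| ≤ C)
    (n : ℕ) : ∑ x, pathLaw μ X (n + 1) x * transSum D n x ^ 2 ≤ n * C ^ 2 := by
  induction n with
  | zero => simp [transSum]
  | succ n ih =>
    have key (x : Fin (n + 1) → S) : ∑ b, P (x (Fin.last n)) b *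
        transSum D (n + 1) (Fin.snoc x b) ^ 2 ≤ transSum D n x ^ 2 + C ^ 2 := by
      set a := x (Fin.last n)
      have h1 : ∑ b, P a b * D a b ^ 2 ≤ C ^ 2 := by
        calc ∑ b, P a b * D a b ^ 2 ≤ ∑ b, P a b * C ^ 2 :=
              Finset.sum_le_sum fun b _ => mul_le_mul_of_nonneg_left
                (sq_le_sq' (abs_le.1 (hC a b)).1 (abs_le.1 (hC a b)).2) (hX.nonneg _ _)
          _ = C ^ 2 := by rw [← Finset.sum_mul, hX.row_sum, one_mul]
      have h2 : ∑ b, P a b * transSum D (n + 1) (Fin.snoc x b) ^ 2 =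
          (∑ b, P a b) * transSum D n x ^ 2 + 2 * transSum D n x * ∑ b, P a b * D a b +
            ∑ b, P a b * D a b ^ 2 := by
        rw [Finset.sum_mul, Finset.mul_sum, ← Finset.sum_add_distrib, ← Finset.sum_add_distrib]
        refine Finset.sum_congr rfl fun b _ => ?_
        rw [transSum_snoc]
        ring
      rw [h2, hD, hX.row_sum]
      linarith
    calc ∑ x, pathLaw μ X (n + 2) x * transSum D (n + 1) x ^ 2
        ≤ ∑ x, pathLaw μ X (n + 1) x * (transSum D n x ^ 2 + C ^ 2) := by
          rw [hX.sum_pathLaw_mul]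
          exact Finset.sum_le_sum fun x _ =>
            mul_le_mul_of_nonneg_left (key x) (pathLaw_nonneg _ _ _)
      _ = ∑ x, pathLaw μ X (n + 1) x * transSum D n x ^ 2 + C ^ 2 := by
          simp only [mul_add, Finset.sum_add_distrib, ← Finset.sum_mul,
            sum_pathLaw hX.measurable, one_mul]
      _ ≤ _ := by push_cast; linarith

/-- The weak law of large numbers for functions of a transition of a renewal chain. With
`F a` the conditional mean of `f` at `a`, the function `F / c` solves the Poisson equation, so that
`f a b - m + (F b - F a) / c` has conditional mean zero; Chebyshev's inequality applies to it. -/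
theorem IsMarkovChain.tendsto_transSum {c : ℝ} {v : S → ℝ} (hc : 0 < c) (hv1 : ∑ i, v i = 1)
    (hX : IsMarkovChain μ X (renewalMatrix c v)) (f : S → S → ℝ) {δ : ℝ} (hδ : 0 < δ) :
    Tendsto (fun n : ℕ => μ.real {ω | n * δ ≤ |transSum f n (fun i => X i ω) -
      n * transMean (renewalMatrix c v) v f|}) atTop (𝓝 0) := by
  classical
  set m := transMean (renewalMatrix c v) v f with hm
  set F : S → ℝ := fun a => ∑ b, renewalMatrix c v a b * f a b with hF
  set D : S → S → ℝ := fun a b => f a b - m + (F b - F a) / c with hDdef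
  have hrow := renewalMatrix_row_sum c hv1
  have hD (a : S) : ∑ b, renewalMatrix c v a b * D a b = 0 := by
    have h1 : ∑ b, renewalMatrix c v a b * F b = c * m + (1 - c) * F a :=
      sum_renewalMatrix_mul c v a F
    have h2 : ∑ b, renewalMatrix c v a b * D a b = F a - (∑ b, renewalMatrix c v a b) * m +
        ((∑ b, renewalMatrix c v a b * F b) - (∑ b, renewalMatrix c v a b) * F a) / c := by
      rw [sub_div, Finset.sum_div, Finset.sum_mul, Finset.sum_mul, Finset.sum_div, hF,
        ← Finset.sum_sub_distrib, ← Finset.sum_sub_distrib, ← Finset.sum_add_distrib]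
      refine Finset.sum_congr rfl fun b _ => ?_
      rw [hDdef]
      ring
    rw [h2, h1, hrow]
    field_simp
    ring
  have hbdd (G : S → S → ℝ) : ∃ C, ∀ a b, |G a b| ≤ C := by
    refine ⟨∑ a, ∑ b, |G a b|, fun a b => ?_⟩
    calc |G a b| ≤ ∑ b, |G a b| :=
          Finset.single_le_sum (f := fun b => |G a b|) (fun b _ => abs_nonneg _) (Finset.mem_univ b)
      _ ≤ _ := Finset.single_le_sum (f := fun a => ∑ b, |G a b|)
          (fun a _ => Finset.sum_nonneg fun b _ => abs_nonneg _) (Finset.mem_univ a)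
  obtain ⟨C, hC⟩ := hbdd D
  obtain ⟨K, hK⟩ := hbdd fun a b => (F b - F a) / c
  have htel (n : ℕ) (x : Fin (n + 1) → S) : transSum D n x =
      transSum f n x - n * m + (F (x (Fin.last n)) - F (x 0)) / c := by
    have := transSum_telescope (fun a => F a / c) n x
    rw [sub_div, ← this]
    simp only [transSum, hDdef, Finset.sum_add_distrib, Finset.sum_sub_distrib, sub_div]
    simp
  have hlim : Tendsto (fun n : ℕ => (4 * C ^ 2 / δ ^ 2) / (n : ℝ)) atTop (𝓝 0) :=
    tendsto_const_div_atTop_nhds_zero_nat _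
  refine squeeze_zero' (Eventually.of_forall fun n => measureReal_nonneg) ?_ hlim
  have hev : ∀ᶠ n : ℕ in atTop, 2 * K / δ ≤ (n : ℝ) :=
    tendsto_natCast_atTop_atTop.eventually_ge_atTop _
  filter_upwards [hev, eventually_gt_atTop 0] with n hn hn0
  have hn0' : (0 : ℝ) < n := by exact_mod_cast hn0
  rw [div_le_iff₀ hδ] at hn
  rw [measureReal_path hX.measurable (n + 1)
    fun x => n * δ ≤ |transSum f n x - n * m|]
  have hq : 0 < (n * δ / 2) ^ 2 := by positivity
  calc ∑ x, pathLaw μ X (n + 1) x * (if n * δ ≤ |transSum f n x - n * m| then 1 else 0)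
      ≤ ∑ x, pathLaw μ X (n + 1) x * (transSum D n x ^ 2 / (n * δ / 2) ^ 2) := by
        refine Finset.sum_le_sum fun x _ =>
          mul_le_mul_of_nonneg_left ?_ (pathLaw_nonneg _ _ _)
        split_ifs with h
        · rw [one_le_div hq, sq_le_sq, abs_of_pos (by positivity)]
          have h1 := hK (x 0) (x (Fin.last n))
          have h2 := abs_sub_abs_le_abs_sub (transSum f n x - n * m)
            (-((F (x (Fin.last n)) - F (x 0)) / c))
          rw [sub_neg_eq_add, ← htel, abs_neg] at h2
          linarith
        · positivity
    _ = (∑ x, pathLaw μ X (n + 1) x * transSum D n x ^ 2) / (n * δ / 2) ^ 2 := by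
        rw [Finset.sum_div]
        exact Finset.sum_congr rfl fun x _ => (mul_div_assoc _ _ _).symm
    _ ≤ n * C ^ 2 / (n * δ / 2) ^ 2 := by
        gcongr
        exact hX.sum_sq_transSum_le hD hC n
    _ = 4 * C ^ 2 / δ ^ 2 / n := by
        field_simp
        ring

end LargeNumbers

/-! ### Counting typical paths in a fibre -/

section Counting

open Classical in
/-- Summing transition probabilities over all paths above a path `y` of a lumped chain leaves the
transition probability of `y`, up to the choice of the initial state. -/
theorem sum_prod_fiber_le {S : Type*} [Fintype S] {P : Matrix S S ℝ} {T : Type*} {f : S → T}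
    {Q : Matrix T T ℝ} (hQ : ∀ i j, 0 ≤ Q i j)
    (h : ∀ a q, (∑ b, if f b = q then P a b else 0) = Q (f a) q) (n : ℕ)
    (y : Fin (n + 1) → T) :
    ∑ x : Fin (n + 1) → S, (if ∀ i, f (x i) = y i then
        ∏ i : Fin n, P (x i.castSucc) (x i.succ) else 0) ≤
      Fintype.card S * ∏ i : Fin n, Q (y i.castSucc) (y i.succ) := by
  induction n with
  | zero =>
    calc _ ≤ ∑ x : Fin 1 → S, (1 : ℝ) :=
          Finset.sum_le_sum fun x _ => by split_ifs <;> simp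
      _ = _ := by simp
  | succ n ih =>
    have key (x : Fin (n + 1) → S) :
        ∑ b, (if ∀ i, f ((Fin.snoc x b : Fin (n + 2) → S) i) = y i then
          ∏ i : Fin (n + 1), P ((Fin.snoc x b : Fin (n + 2) → S) i.castSucc)
            ((Fin.snoc x b : Fin (n + 2) → S) i.succ) else 0) =
        (if ∀ i, f (x i) = y i.castSucc then ∏ i : Fin n, P (x i.castSucc) (x i.succ) else 0) *
          Q (y (Fin.last n).castSucc) (y (Fin.last (n + 1))) := by
      simp only [Fin.forall_fin_succ' (n := n + 1), Fin.prod_univ_castSucc (n := n),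
        Fin.snoc_castSucc, Fin.succ_last, Fin.snoc_last, Fin.succ_castSucc]
      by_cases hx : ∀ i, f (x i) = y i.castSucc
      · simp only [hx, implies_true, true_and, if_true]
        rw [← hx (Fin.last n), ← h, Finset.mul_sum]
        simp only [mul_ite, mul_zero]
      · simp [hx]
    rw [sum_snoc]
    simp only [key]
    rw [← Finset.sum_mul, Fin.prod_univ_castSucc, ← mul_assoc]
    exact mul_le_mul_of_nonneg_right (ih fun i => y i.castSucc) (hQ _ _)

theorem prod_eq_rpow_transSum {S : Type*} {P : S → S → ℝ} (hP : ∀ a b, 0 < P a b) (n : ℕ)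
    (x : Fin (n + 1) → S) : ∏ i : Fin n, P (x i.castSucc) (x i.succ) =
      (2 : ℝ) ^ (-transSum (fun a b => -Real.logb 2 (P a b)) n x) := by
  unfold transSum
  rw [Finset.sum_neg_distrib, neg_neg, ← Real.logb_prod _ _ fun i _ => (hP _ _).ne',
    Real.rpow_logb two_pos (by norm_num) (Finset.prod_pos fun i _ => hP _ _)]

open Classical in
/-- Among paths whose transition probability is at least `2 ^ (-n (H + δ))`, at most
`2 ^ (n (H - L + 2 δ))`, up to a constant, lie above the same path of the lumped chain when this
one has transition probability at most `2 ^ (-n (L - δ))`. -/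
theorem card_typical_fiber_le {S : Type*} [Fintype S] {P : Matrix S S ℝ} (hP : ∀ a b, 0 < P a b)
    {T : Type*} {f : S → T} {Q : Matrix T T ℝ} (hQ : ∀ i j, 0 ≤ Q i j)
    (hQf : ∀ a b, 0 < Q (f a) (f b))
    (h : ∀ a q, (∑ b, if f b = q then P a b else 0) = Q (f a) q) {n : ℕ} {H L δ : ℝ}
    (A : Finset (Fin (n + 1) → S))
    (hA : ∀ x ∈ A, transSum (fun a b => -Real.logb 2 (P a b)) n x ≤ n * (H + δ))
    (z : Fin (n + 1) → S)
    (hz : n * (L - δ) ≤ transSum (fun a b => -Real.logb 2 (Q (f a) (f b))) n z) :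
    ((A.filter fun x => ∀ i, f (x i) = f (z i)).card : ℝ) ≤
      Fintype.card S * (2 : ℝ) ^ (n * (H - L + 2 * δ)) := by
  set B := A.filter fun x => ∀ i, f (x i) = f (z i) with hB
  have h1 : (B.card : ℝ) * (2 : ℝ) ^ (-(n * (H + δ))) ≤
      ∑ x ∈ B, ∏ i : Fin n, P (x i.castSucc) (x i.succ) := by
    rw [← nsmul_eq_mul]
    refine Finset.card_nsmul_le_sum _ _ _ fun x hx => ?_
    rw [prod_eq_rpow_transSum hP]
    have := hA x (Finset.mem_filter.1 hx).1
    exact Real.rpow_le_rpow_of_exponent_le one_le_two (by linarith)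
  have h2 : ∑ x ∈ B, ∏ i : Fin n, P (x i.castSucc) (x i.succ) ≤
      Fintype.card S * ∏ i : Fin n, Q (f (z i.castSucc)) (f (z i.succ)) := by
    refine le_trans ?_ (sum_prod_fiber_le hQ h n fun i => f (z i))
    rw [← Finset.sum_filter]
    refine Finset.sum_le_sum_of_subset_of_nonneg
      (Finset.filter_subset_filter _ (Finset.subset_univ _)) fun x _ _ => ?_
    exact Finset.prod_nonneg fun i _ => (hP _ _).le
  have h3 : ∏ i : Fin n, Q (f (z i.castSucc)) (f (z i.succ)) ≤ (2 : ℝ) ^ (-(n * (L - δ))) := by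
    rw [prod_eq_rpow_transSum (P := fun a b => Q (f a) (f b)) hQf]
    exact Real.rpow_le_rpow_of_exponent_le one_le_two (by linarith)
  have h4 : (B.card : ℝ) * (2 : ℝ) ^ (-(n * (H + δ))) ≤
      Fintype.card S * (2 : ℝ) ^ (-(n * (L - δ))) :=
    h1.trans (h2.trans (mul_le_mul_of_nonneg_left h3 (Nat.cast_nonneg _)))
  have e : (2 : ℝ) ^ (n * (H - L + 2 * δ)) =
      (2 : ℝ) ^ (-(n * (L - δ))) * (2 : ℝ) ^ (n * (H + δ)) := by
    rw [← Real.rpow_add two_pos]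
    ring_nf
  rw [e, ← mul_assoc]
  calc (B.card : ℝ) = B.card * (2 : ℝ) ^ (-(n * (H + δ))) * (2 : ℝ) ^ (n * (H + δ)) := by
        rw [mul_assoc, ← Real.rpow_add two_pos]; simp
    _ ≤ _ := by gcongr

end Counting

/-! ### Random linear codes over a finite ring -/

section LinearCodes

variable {R : Type*} [Ring R] [Fintype R]

/-- For a uniform row `r`, the combination `∑ rᵢ dᵢ` is uniform on the left ideal generated by
the `dᵢ`. -/
theorem card_ker_mul_card_span {N : ℕ} (d : Fin N → R) :
    Nat.card {r : Fin N → R // ∑ i, r i * d i = 0} * Nat.card (Ideal.span (Set.range d)) =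
      Nat.card R ^ N := by
  have h1 := Submodule.card_eq_card_quotient_mul_card
    (LinearMap.ker (Fintype.linearCombination R d))
  have h2 : Nat.card ((Fin N → R) ⧸ LinearMap.ker (Fintype.linearCombination R d)) =
      Nat.card (Ideal.span (Set.range d)) := by
    rw [Nat.card_congr (LinearMap.quotKerEquivRange _).toEquiv, Fintype.range_linearCombination]
  have h3 : Nat.card (LinearMap.ker (Fintype.linearCombination R d)) =
      Nat.card {r : Fin N → R // ∑ i, r i * d i = 0} :=
    Nat.card_congr (Equiv.subtypeEquivRight fun r => by
      simp [LinearMap.mem_ker, Fintype.linearCombination_apply])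
  rw [h2, h3] at h1
  rw [← h1]
  simp

theorem card_mulVec_eq_zero {K N : ℕ} (d : Fin N → R) :
    (Nat.card {A : Matrix (Fin K) (Fin N) R // A.mulVec d = 0} : ℝ) =
      Nat.card (Matrix (Fin K) (Fin N) R) / Nat.card (Ideal.span (Set.range d)) ^ K := by
  have e : {A : Matrix (Fin K) (Fin N) R // A.mulVec d = 0} ≃
      (Fin K → {r : Fin N → R // ∑ i, r i * d i = 0}) :=
    { toFun := fun A j => ⟨A.1 j, congrFun A.2 j⟩
      invFun := fun r => ⟨fun j => (r j).1, funext fun j => (r j).2⟩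
      left_inv := fun A => rfl
      right_inv := fun r => rfl }
  have h := card_ker_mul_card_span d
  have hM : Nat.card (Matrix (Fin K) (Fin N) R) = (Nat.card R ^ N) ^ K := by
    simp [Matrix, Nat.card_eq_fintype_card]
  have hI : (Nat.card (Ideal.span (Set.range d)) : ℝ) ≠ 0 := by
    exact_mod_cast Nat.card_pos.ne'
  rw [eq_div_iff (pow_ne_zero _ hI), Nat.card_congr e, hM, ← h]
  simp [mul_pow, Nat.card_pi]

/-- The word `z` of `T` has the same image under `A` as another word of `T`; the words are read in
the ring through `ι`. -/
def IsConfused {S : Type*} (ι : S → R) {K N : ℕ} (A : Matrix (Fin K) (Fin N) R)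
    (T : Finset (Fin N → S)) (z : Fin N → S) : Prop :=
  z ∈ T ∧ ∃ z' ∈ T, z' ≠ z ∧ A.mulVec (ι ∘ z') = A.mulVec (ι ∘ z)

open Classical in
/-- Random coding: if from each word of a set `T` of words over `S` at most `B I` words of `T`
differ by entries in the left ideal `I`, then some matrix `A` with `K` rows confuses words of `T`
with probability at most `∑ B I / |I| ^ K`. -/
theorem exists_matrix_error_le [Fintype {I : Ideal R // I ≠ ⊥}] {S : Type*} [Fintype S]
    {ι : S → R} (hι : Function.Injective ι) {N : ℕ} (K : ℕ) (p : (Fin N → S) → ℝ)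
    (hp : ∀ z, 0 ≤ p z) (hp1 : ∑ z, p z ≤ 1) (T : Finset (Fin N → S))
    (B : {I : Ideal R // I ≠ ⊥} → ℝ) (hB0 : ∀ I, 0 ≤ B I)
    (hB : ∀ I, ∀ z ∈ T, ((T.filter fun z' => ∀ i, ι (z' i) - ι (z i) ∈ I.1).card : ℝ) ≤ B I) :
    ∃ A : Matrix (Fin K) (Fin N) R,
      (∑ z, p z * if IsConfused ι A T z then 1 else 0) ≤ ∑ I, B I / (Nat.card I.1 : ℝ) ^ K := by
  set M := Matrix (Fin K) (Fin N) R
  have hM : (0 : ℝ) < Nat.card M := by exact_mod_cast Nat.card_pos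
  -- the expected number of words confused with a given word
  have hz (z : Fin N → S) (hzT : z ∈ T) :
      (∑ A : M, if IsConfused ι A T z then (1 : ℝ) else 0) ≤
        Nat.card M * ∑ I, B I / (Nat.card I.1 : ℝ) ^ K := by
    have hpair (z' : Fin N → S) (hne : z' ≠ z) :
        (∑ A : M, if A.mulVec (ι ∘ z') = A.mulVec (ι ∘ z) then (1 : ℝ) else 0) ≤
        Nat.card M * ∑ I : {I : Ideal R // I ≠ ⊥},
          (if ∀ i, ι (z' i) - ι (z i) ∈ I.1 then (1 : ℝ) else 0) / (Nat.card I.1 : ℝ) ^ K := by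
      set d : Fin N → R := ι ∘ z' - ι ∘ z with hd
      have hspan : Ideal.span (Set.range d) ≠ ⊥ := by
        intro hbot
        refine hne (funext fun i => hι ?_)
        have : d i ∈ Ideal.span (Set.range d) := Ideal.subset_span ⟨i, rfl⟩
        rw [hbot, Ideal.mem_bot] at this
        exact sub_eq_zero.1 this
      have h1 : (∑ A : M, if A.mulVec (ι ∘ z') = A.mulVec (ι ∘ z) then (1 : ℝ) else 0) =
          Nat.card {A : M // A.mulVec d = 0} := by
        rw [Nat.card_eq_fintype_card, Fintype.card_subtype, Finset.sum_boole]
        simp only [hd, Matrix.mulVec_sub, sub_eq_zero]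
      rw [h1, card_mulVec_eq_zero, div_eq_mul_one_div]
      refine mul_le_mul_of_nonneg_left ?_ hM.le
      refine le_trans (le_of_eq ?_) (Finset.single_le_sum (f := fun I : {I : Ideal R // I ≠ ⊥} =>
        (if ∀ i, ι (z' i) - ι (z i) ∈ I.1 then (1 : ℝ) else 0) / (Nat.card I.1 : ℝ) ^ K)
        (fun I _ => by positivity) (Finset.mem_univ ⟨_, hspan⟩))
      rw [if_pos]
      exact fun i => Ideal.subset_span ⟨i, rfl⟩
    calc _ ≤ ∑ A : M, ∑ z' ∈ T.filter (· ≠ z),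
          if A.mulVec (ι ∘ z') = A.mulVec (ι ∘ z) then (1 : ℝ) else 0 := by
          refine Finset.sum_le_sum fun A _ => ?_
          split_ifs with h
          · obtain ⟨_, z', hz', hne, he⟩ := h
            refine le_trans (le_of_eq ?_) (Finset.single_le_sum
              (f := fun z' => if A.mulVec (ι ∘ z') = A.mulVec (ι ∘ z) then (1 : ℝ) else 0)
              (fun z' _ => by positivity) (Finset.mem_filter.2 ⟨hz', hne⟩))
            rw [if_pos he]
          · exact Finset.sum_nonneg fun z' _ => by positivity
      _ = ∑ z' ∈ T.filter (· ≠ z), ∑ A : M,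
          if A.mulVec (ι ∘ z') = A.mulVec (ι ∘ z) then (1 : ℝ) else 0 := Finset.sum_comm
      _ ≤ ∑ z' ∈ T.filter (· ≠ z), Nat.card M * ∑ I : {I : Ideal R // I ≠ ⊥},
          (if ∀ i, ι (z' i) - ι (z i) ∈ I.1 then (1 : ℝ) else 0) / (Nat.card I.1 : ℝ) ^ K :=
          Finset.sum_le_sum fun z' hz' => hpair z' (Finset.mem_filter.1 hz').2
      _ ≤ ∑ z' ∈ T, Nat.card M * ∑ I : {I : Ideal R // I ≠ ⊥},
          (if ∀ i, ι (z' i) - ι (z i) ∈ I.1 then (1 : ℝ) else 0) / (Nat.card I.1 : ℝ) ^ K :=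
          Finset.sum_le_sum_of_subset_of_nonneg (Finset.filter_subset _ _)
            fun z' _ _ => mul_nonneg hM.le (Finset.sum_nonneg fun I _ => by positivity)
      _ = Nat.card M * ∑ I : {I : Ideal R // I ≠ ⊥},
          ((T.filter fun z' => ∀ i, ι (z' i) - ι (z i) ∈ I.1).card : ℝ) /
            (Nat.card I.1 : ℝ) ^ K := by
          rw [← Finset.mul_sum, Finset.sum_comm]
          simp only [← Finset.sum_div, Finset.sum_boole]
      _ ≤ _ := by
          gcongr with I
          exact hB I z hzT
  have hE : 0 ≤ ∑ I, B I / (Nat.card I.1 : ℝ) ^ K :=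
    Finset.sum_nonneg fun I _ => div_nonneg (hB0 I) (by positivity)
  have hsum : (∑ A : M, ∑ z, p z * if IsConfused ι A T z then 1 else 0) ≤
      ∑ _A : M, ∑ I, B I / (Nat.card I.1 : ℝ) ^ K := by
    rw [Finset.sum_comm, Finset.sum_const, Finset.card_univ, nsmul_eq_mul,
      ← Nat.card_eq_fintype_card]
    calc _ ≤ ∑ z, p z * (Nat.card M * ∑ I, B I / (Nat.card I.1 : ℝ) ^ K) := by
          refine Finset.sum_le_sum fun z _ => ?_
          rw [← Finset.mul_sum]
          refine mul_le_mul_of_nonneg_left ?_ (hp z)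
          by_cases hzT : z ∈ T
          · exact hz z hzT
          · simpa [IsConfused, hzT] using mul_nonneg hM.le hE
      _ ≤ _ := by
          rw [← Finset.sum_mul]
          exact mul_le_of_le_one_left (mul_nonneg hM.le hE) hp1
  obtain ⟨A, -, hA⟩ := Finset.exists_le_of_sum_le Finset.univ_nonempty hsum
  exact ⟨A, hA⟩

/-- A matrix over `R` yields encoders and a decoder for a presented function: every source sends
the product of `A` with the image of its block, the decoder adds the messages and looks for a word
of `T` with this syndrome. -/
theorem exists_code {s : ℕ} {𝒳 : Fin s → Type*} {𝒴 : Type*} {g : (∀ t, 𝒳 t) → 𝒴}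
    {k : ∀ t, 𝒳 t → R} {h : R → 𝒴} (hg : IsPresentation g k h) {N K : ℕ} {r : ℝ}
    (hK : (Nat.card R : ℝ) ^ K ≤ (2 : ℝ) ^ ((N : ℝ) * r)) (A : Matrix (Fin K) (Fin N) R)
    (T : Finset (Fin N → sumRange k)) :
    ∃ (φ : ∀ t, (Fin N → 𝒳 t) → MessageSet N r) (ψ : (Fin s → MessageSet N r) → (Fin N → 𝒴)),
      ∀ x : Fin N → (∀ t, 𝒳 t), ∀ z ∈ T, (∀ i, (z i : R) = ∑ t, k t (x i t)) →
        (∀ z' ∈ T, A.mulVec (Subtype.val ∘ z') = A.mulVec (Subtype.val ∘ z) → z' = z) →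
        (fun i => g (x i)) = ψ fun t => φ t fun i => x i t := by
  classical
  let e₀ := Fintype.equivFin (Fin K → R)
  have hcard : (Fintype.card (Fin K → R) : ℝ) = (Nat.card R : ℝ) ^ K := by simp
  let e : (Fin K → R) → MessageSet N r := fun w => ⟨e₀ w + 1, by omega, by
    refine le_trans ?_ hK
    rw [← hcard]
    exact_mod_cast (e₀ w).2⟩
  have he : Function.Injective e := fun w w' hw => by
    have h1 : (e₀ w : ℕ) + 1 = e₀ w' + 1 := congrArg Subtype.val hw
    exact e₀.injective (Fin.ext (by omega))
  let S : (Fin s → MessageSet N r) → (Fin K → R) := fun m => ∑ t, Function.invFun e (m t)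
  refine ⟨fun t x => e (A.mulVec fun i => k t (x i)), fun m =>
    if hm : ∃ z ∈ T, A.mulVec (Subtype.val ∘ z) = S m then fun i => h (hm.choose i)
    else fun _ => h 0, fun x z hz hx huniq => ?_⟩
  have hS : S (fun t => e (A.mulVec fun i => k t (x i t))) = A.mulVec (Subtype.val ∘ z) := by
    simp only [S, Function.leftInverse_invFun he _]
    rw [← Matrix.mulVec_sum]
    congr 1
    funext i
    simp [hx]
  have hm : ∃ z' ∈ T, A.mulVec (Subtype.val ∘ z') =
      S (fun t => e (A.mulVec fun i => k t (x i t))) := ⟨z, hz, hS.symm⟩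
  beta_reduce
  rw [dif_pos hm]
  have := huniq _ hm.choose_spec.1 (hm.choose_spec.2.trans hS)
  funext i
  rw [this, hx, hg]

end LinearCodes

/-! ### Entropy rates of renewal chains -/

section Entropy

theorem matrixEntropy_eq_transMean {S : Type*} [Fintype S] (P : Matrix S S ℝ) (π : S → ℝ) :
    matrixEntropy P π = transMean P π fun a b => -Real.logb 2 (P a b) := by
  simp only [matrixEntropy, transMean, mul_neg, Finset.sum_neg_distrib, Finset.mul_sum, mul_assoc]

theorem matrixEntropy_pushWeight {S T : Type*} [Fintype S] [Fintype T] (f : S → T) (c : ℝ)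
    (v : S → ℝ) :
    matrixEntropy (renewalMatrix c (pushWeight f v)) (pushWeight f v) =
      transMean (renewalMatrix c v) v fun a b =>
        -Real.logb 2 (renewalMatrix c (pushWeight f v) (f a) (f b)) := by
  rw [matrixEntropy_eq_transMean, transMean, sum_pushWeight_mul f v fun q =>
    ∑ b, renewalMatrix c (pushWeight f v) q b *
      -Real.logb 2 (renewalMatrix c (pushWeight f v) q b)]
  simp only [sum_renewalMatrix_mul_comp f c v _ fun b =>
    -Real.logb 2 (renewalMatrix c (pushWeight f v) _ b)]
  rfl

theorem matrixEntropy_nonneg {S : Type*} [Fintype S] {P : Matrix S S ℝ} {π : S → ℝ}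
    (hP : ∀ i j, 0 ≤ P i j) (hP1 : ∀ i, ∑ j, P i j = 1) (hπ : ∀ i, 0 ≤ π i) :
    0 ≤ matrixEntropy P π := by
  rw [matrixEntropy, neg_nonneg]
  refine Finset.sum_nonpos fun i _ => Finset.sum_nonpos fun j _ =>
    mul_nonpos_of_nonneg_of_nonpos (mul_nonneg (hπ i) (hP i j))
      (Real.logb_nonpos one_lt_two (hP i j) ?_)
  rw [← hP1 i]
  exact Finset.single_le_sum (fun j _ => hP i j) (Finset.mem_univ j)

variable {Ω : Type*} [MeasurableSpace Ω] {μ : Measure Ω} [IsProbabilityMeasure μ]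
  {T : Type*} [Fintype T] {Y : ℕ → Ω → T} {c : ℝ} {w : T → ℝ}

theorem IsMarkovChain.measureReal_succ
    (hY : IsMarkovChain μ Y (renewalMatrix c w)) (m : ℕ) (b : T) :
    μ.real {ω | Y (m + 1) ω = b} = c * w b + (1 - c) * μ.real {ω | Y m ω = b} := by
  classical
  have h1 := measureReal_path (μ := μ) hY.measurable (m + 2) fun x => x (Fin.last (m + 1)) = b
  have h2 := measureReal_path (μ := μ) hY.measurable (m + 1) fun x => x (Fin.last m) = b
  simp only [Fin.val_last] at h1 h2
  have h3 (x : Fin (m + 1) → T) : ∑ b', renewalMatrix c w (x (Fin.last m)) b' *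
      (if (Fin.snoc x b' : Fin (m + 2) → T) (Fin.last (m + 1)) = b then 1 else 0) =
      c * w b + (1 - c) * if x (Fin.last m) = b then 1 else 0 := by
    simp only [Fin.snoc_last]
    rw [sum_renewalMatrix_mul]
    simp
  rw [h1, h2, hY.sum_pathLaw_mul]
  simp only [h3, mul_add, Finset.sum_add_distrib, ← Finset.sum_mul, sum_pathLaw hY.measurable,
    one_mul, Finset.mul_sum, mul_left_comm (1 - c)]

/-- A renewal chain converges in law to its weights, geometrically. -/
theorem IsMarkovChain.tendsto_measureReal (hc : 0 < c) (hc1 : c ≤ 1)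
    (hY : IsMarkovChain μ Y (renewalMatrix c w)) (b : T) :
    Tendsto (fun m => μ.real {ω | Y m ω = b}) atTop (𝓝 (w b)) := by
  have h (m : ℕ) : μ.real {ω | Y m ω = b} =
      w b + (1 - c) ^ m * (μ.real {ω | Y 0 ω = b} - w b) := by
    induction m with
    | zero => simp
    | succ m ih => rw [hY.measureReal_succ, ih]; ring
  rw [funext h]
  have := (tendsto_pow_atTop_nhds_zero_of_lt_one (sub_nonneg.2 hc1)
    (by linarith : 1 - c < 1)).mul_const (μ.real {ω | Y 0 ω = b} - w b)
  simpa using this.const_add (w b)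

theorem IsMarkovChain.condEntropy_eq {P : Matrix T T ℝ} (hY : IsMarkovChain μ Y P) (m : ℕ) :
    condEntropy μ (Y (m + 1)) (Y m) = matrixEntropy P fun a => μ.real {ω | Y m ω = a} := by
  unfold condEntropy matrixEntropy
  congr 1
  refine Finset.sum_congr rfl fun a _ => Finset.sum_congr rfl fun b _ => ?_
  rw [hY.measureReal_step]
  rcases eq_or_ne (μ.real {ω | Y m ω = a}) 0 with h0 | h0
  · simp [h0]
  · rw [mul_div_cancel_left₀ _ h0]

theorem IsMarkovChain.tendsto_condEntropy (hc : 0 < c) (hc1 : c ≤ 1)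
    (hY : IsMarkovChain μ Y (renewalMatrix c w)) :
    Tendsto (fun m => condEntropy μ (Y (m + 1)) (Y m)) atTop
      (𝓝 (matrixEntropy (renewalMatrix c w) w)) := by
  -- `condEntropy` is linear in the law of the first symbol
  simp only [hY.condEntropy_eq]
  unfold matrixEntropy
  exact (tendsto_finsetSum _ fun a _ => tendsto_finsetSum _ fun b _ =>
    ((hY.tendsto_measureReal hc hc1 a).mul_const _).mul_const _).neg

end Entropy

/-! ### Stochastic complements of renewal matrices -/

section Complement

variable {S : Type*} [Fintype S]

open Classical in
/-- Watched on the states satisfying `A` only, a renewal chain is the renewal chain for the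
weights conditioned on `A`. -/
theorem stochasticComplement_renewalMatrix {c : ℝ} {v : S → ℝ} (hc : 0 < c)
    (hv : ∀ i, 0 < v i) (hv1 : ∑ i, v i = 1) (A : S → Prop) (i j : {i // A i}) :
    stochasticComplement (renewalMatrix c v) A i j =
      c * (v j / ∑ z : {z // A z}, v z) + (1 - c) * if (i : S) = j then 1 else 0 := by
  set a := ∑ z : {z // A z}, v z with ha
  set b := ∑ z : {z // ¬ A z}, v z with hb
  have hab : a + b = 1 := by
    rw [← hv1]
    exact Fintype.sum_subtype_add_sum_subtype A v
  have ha0 : 0 < a := Finset.sum_pos (fun z _ => hv z) ⟨i, Finset.mem_univ _⟩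
  -- the block outside `A` is `1` minus a rank one matrix, with an explicit inverse
  have hinv : (1 - (renewalMatrix c v).toBlock (fun i => ¬ A i) (fun i => ¬ A i))⁻¹ =
      Matrix.of fun k l : {i // ¬ A i} => c⁻¹ * ((if k = l then 1 else 0) + v l / a) := by
    refine Matrix.inv_eq_right_inv ?_
    ext k l
    have e (m : {i // ¬ A i}) : (1 - (renewalMatrix c v).toBlock (fun i => ¬ A i)
        (fun i => ¬ A i)) k m * (c⁻¹ * ((if m = l then 1 else 0) + v l / a)) =
        (if k = m then (if m = l then 1 else 0) + v l / a else 0) -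
          (if m = l then v m else 0) - v m * (v l / a) := by
      simp only [Matrix.sub_apply, Matrix.one_apply, Matrix.toBlock_apply, renewalMatrix,
        Subtype.coe_inj]
      split_ifs <;> field_simp <;> ring
    rw [Matrix.mul_apply]
    simp only [Matrix.of_apply, e, Finset.sum_sub_distrib, ← Finset.sum_mul, ← hb]
    simp only [Finset.sum_ite_eq, Finset.sum_ite_eq', Finset.mem_univ, if_true, Matrix.one_apply]
    rw [show b = 1 - a by linarith]
    field_simp
    ring
  have h1 (k : {i // ¬ A i}) : renewalMatrix c v i k = c * v k := by
    have : (i : S) ≠ k := fun h => k.2 (h ▸ i.2)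
    simp [renewalMatrix, this]
  have h2 (k : {i // ¬ A i}) : renewalMatrix c v k j = c * v j := by
    have : (k : S) ≠ j := fun h => k.2 (h ▸ j.2)
    simp [renewalMatrix, this]
  unfold stochasticComplement
  rw [hinv, Matrix.add_apply, Matrix.mul_apply]
  have h3 (l : {i // ¬ A i}) : ((renewalMatrix c v).toBlock A (fun i => ¬ A i) *
      Matrix.of fun k l : {i // ¬ A i} => c⁻¹ * ((if k = l then 1 else 0) + v l / a)) i l =
      v l / a := by
    rw [Matrix.mul_apply]
    have e (k : {i // ¬ A i}) : (renewalMatrix c v).toBlock A (fun i => ¬ A i) i k *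
        (c⁻¹ * ((if k = l then 1 else 0) + v l / a)) =
        (if k = l then v k else 0) + v k * (v l / a) := by
      simp only [Matrix.toBlock_apply, h1]
      split_ifs <;> field_simp
      ring
    simp only [Matrix.of_apply, e, Finset.sum_add_distrib, ← Finset.sum_mul, ← hb]
    simp only [Finset.sum_ite_eq', Finset.mem_univ, if_true]
    rw [show b = 1 - a by linarith]
    field_simp
    ring
  simp only [h3, Matrix.toBlock_apply, h2, ← Finset.sum_mul, ← Finset.sum_div, ← hb]
  rw [show b = 1 - a by linarith, renewalMatrix]
  field_simp
  ring

open Classical in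
theorem diagComplement_renewalMatrix {T : Type*} {c : ℝ} {v : S → ℝ} (hc : 0 < c)
    (hv : ∀ i, 0 < v i) (hv1 : ∑ i, v i = 1) (f : S → T) (i j : S) :
    diagComplement (renewalMatrix c v) f i j = if f j = f i then
      c * (v j / pushWeight f v (f i)) + (1 - c) * (if i = j then 1 else 0) else 0 := by
  have hs : ∑ z : {z // f z = f i}, v z = pushWeight f v (f i) := by
    rw [pushWeight, ← Finset.sum_filter]
    exact (Finset.sum_subtype _ (by simp) _).symm
  unfold diagComplement
  split_ifs with h1 h2
  all_goals try rfl
  all_goals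
    rw [stochasticComplement_renewalMatrix hc hv hv1, hs]
    simp [h2]

theorem convex_comb_mul_logb_le {p q x y : ℝ} (hp : 0 ≤ p) (hq : 0 ≤ q) (hpq : p + q = 1)
    (hx : 0 ≤ x) (hy : 0 ≤ y) : p * -(x * Real.logb 2 x) + q * -(y * Real.logb 2 y) ≤
      -((p * x + q * y) * Real.logb 2 (p * x + q * y)) := by
  have h := Real.concaveOn_negMulLog.2 (Set.mem_Ici.2 hx) (Set.mem_Ici.2 hy) hp hq hpq
  simp only [Real.negMulLog, smul_eq_mul] at h
  have h2 : 0 < Real.log 2 := Real.log_pos one_lt_two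
  have h3 := div_le_div_of_nonneg_right h h2.le
  refine le_trans (le_of_eq ?_) (h3.trans (le_of_eq ?_)) <;> simp only [Real.logb] <;> ring

/-- The entropy of the stochastic complements is never smaller than the entropy rate of the chain
minus the entropy rate of the lumped chain. In a class of weight `a`, the next visited state is
reached directly with probability `q = c a + 1 - c`, and is otherwise a fresh state of the class;
the inequality is concavity of entropy for this mixture. -/
theorem matrixEntropy_sub_le_diagComplement {T : Type*} [Fintype T] {c : ℝ} {v : S → ℝ}
    (hc : 0 < c) (hc1 : c ≤ 1) (hv : ∀ i, 0 < v i) (hv1 : ∑ i, v i = 1) (f : S → T) :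
    matrixEntropy (renewalMatrix c v) v -
        matrixEntropy (renewalMatrix c (pushWeight f v)) (pushWeight f v) ≤
      matrixEntropy (diagComplement (renewalMatrix c v) f) v := by
  classical
  rw [matrixEntropy_pushWeight, matrixEntropy_eq_transMean, matrixEntropy_eq_transMean]
  set w : S → ℝ := fun z => pushWeight f v (f z) with hw
  have hw0 (z : S) : 0 < w z := pushWeight_pos f hv z
  have hw1 (z : S) : w z ≤ 1 := by
    rw [← hv1]
    exact Finset.sum_le_sum fun i _ => by split_ifs <;> simp [(hv i).le]
  set l : S → ℝ := fun z => -Real.logb 2 (v z / w z) with hl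
  set P := renewalMatrix c v with hP
  have hPpos (i j : S) : 0 < P i j := renewalMatrix_pos hc hc1 i (hv j)
  set Q := renewalMatrix c (pushWeight f v) with hQ
  have hQpos (i j : S) : 0 < Q (f i) (f j) := renewalMatrix_pos hc hc1 _ (hw0 j)
  set U : S → S → ℝ := fun i j =>
    if f j = f i then P i j * (Real.logb 2 (Q (f i) (f j)) - Real.logb 2 (P i j)) else 0 with hU
  -- contribution of the transitions between different classes
  set V : S → S → ℝ := fun i j => if f j = f i then 0 else c * v j * l j with hV
  -- contribution of the returns to a class
  set W : S → S → ℝ := fun i j =>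
    if f j = f i then c * (1 - w j) * (v j / w j) * l j else 0 with hW
  have hleft : transMean P v (fun a b => -Real.logb 2 (P a b)) -
      transMean P v (fun a b => -Real.logb 2 (Q (f a) (f b))) =
      ∑ i, v i * ∑ j, (U i j + V i j) := by
    unfold transMean
    rw [← Finset.sum_sub_distrib]
    refine Finset.sum_congr rfl fun i _ => ?_
    rw [← mul_sub, ← Finset.sum_sub_distrib]
    congr 1
    refine Finset.sum_congr rfl fun j _ => ?_
    simp only [hU, hV]
    split_ifs with hij
    · ring
    · have hne : i ≠ j := fun h => hij (h ▸ rfl)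
      have hP' : P i j = c * v j := by simp [hP, renewalMatrix, hne]
      have hQ' : Q (f i) (f j) = c * w j := by simp [hQ, hw, renewalMatrix, Ne.symm hij]
      have hlj : l j = Real.logb 2 (c * w j) - Real.logb 2 (c * v j) := by
        rw [hl, Real.logb_mul hc.ne' (hw0 j).ne', Real.logb_mul hc.ne' (hv j).ne']
        simp only [Real.logb_div (hv j).ne' (hw0 j).ne']
        ring
      rw [hP', hQ', hlj]
      ring
  have hswap : ∑ i, v i * ∑ j, V i j = ∑ i, v i * ∑ j, W i j := by
    simp only [Finset.mul_sum]
    rw [Finset.sum_comm, Finset.sum_comm (f := fun i j => v i * W i j)]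
    refine Finset.sum_congr rfl fun j _ => ?_
    have h1 : ∑ i, v i * V i j = (1 - w j) * (c * v j * l j) := by
      rw [hw, ← hv1]
      simp only [pushWeight]
      rw [← Finset.sum_sub_distrib, Finset.sum_mul]
      refine Finset.sum_congr rfl fun i _ => ?_
      simp only [hV, eq_comm (a := f j)]
      split_ifs <;> ring
    have h2 : ∑ i, v i * W i j = w j * (c * (1 - w j) * (v j / w j) * l j) := by
      conv_rhs => enter [1]; rw [hw]
      simp only [pushWeight]
      rw [Finset.sum_mul]
      refine Finset.sum_congr rfl fun i _ => ?_
      simp only [hW, eq_comm (a := f j)]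
      split_ifs <;> ring
    rw [h1, h2]
    have := (hw0 j).ne'
    field_simp
  have hright : ∑ i, v i * ∑ j, (U i j + W i j) ≤
      transMean (diagComplement P f) v fun a b => -Real.logb 2 (diagComplement P f a b) := by
    unfold transMean
    refine Finset.sum_le_sum fun i _ => mul_le_mul_of_nonneg_left
      (Finset.sum_le_sum fun j _ => ?_) (hv i).le
    by_cases hij : f j = f i
    · have hwj : pushWeight f v (f i) = w j := by simp only [hw, hij]
      set q := Q (f i) (f j) with hq
      have hq0 : 0 < q := hQpos i j
      have hq' : q = c * w j + (1 - c) := by simp [hq, hQ, hw, renewalMatrix, hij]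
      have hq1 : 1 - q = c * (1 - w j) := by rw [hq']; ring
      have hconv := convex_comb_mul_logb_le hq0.le
        (hq1 ▸ mul_nonneg hc.le (sub_nonneg.2 (hw1 j)) : 0 ≤ 1 - q) (by ring)
        (div_nonneg (hPpos i j).le hq0.le) (div_nonneg (hv j).le (hw0 j).le)
      have hD : diagComplement P f i j = q * (P i j / q) + (1 - q) * (v j / w j) := by
        rw [mul_div_cancel₀ _ hq0.ne', hq1, hP, diagComplement_renewalMatrix hc hv hv1 f i j,
          if_pos hij, hwj, renewalMatrix]
        have := (hw0 j).ne'
        field_simp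
        ring
      beta_reduce
      rw [hD, mul_neg]
      refine le_trans (le_of_eq ?_) hconv
      simp only [hU, hW, if_pos hij, ← hq]
      rw [hq1, hl, Real.logb_div (hPpos i j).ne' hq0.ne']
      field_simp
      ring
    · simp [hU, hW, hP, diagComplement_renewalMatrix hc hv hv1 f i j, hij]
  rw [hleft]
  simp only [Finset.sum_add_distrib, mul_add] at hright ⊢
  rw [hswap]
  exact hright

end Complement

/-! ### Achievability -/

section Achievability

variable {Ω : Type*} [MeasurableSpace Ω] {μ : Measure Ω} [IsProbabilityMeasure μ]
  {s : ℕ} {𝒳 : Fin s → Type*} {𝒴 : Type*}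

/-- The entropy rate of the process of cosets of `I` of a renewal chain in a set `T` of ring
elements. -/
noncomputable def cosetEntropy {R : Type*} [Ring R] [Fintype R] {T : Set R} [Fintype T]
    (c : ℝ) (v : T → ℝ) (I : Ideal R) : ℝ :=
  matrixEntropy (renewalMatrix c (pushWeight (coset I) v)) (pushWeight (coset I) v)

theorem cosetEntropy_top {R : Type*} [Ring R] [Fintype R] {T : Set R} [Fintype T] (c : ℝ)
    {v : T → ℝ} (hv1 : ∑ z, v z = 1) : cosetEntropy c v (⊤ : Ideal R) = 0 := by
  have hs : Subsingleton (R ⧸ (⊤ : Ideal R)) := Submodule.Quotient.subsingleton_iff.2 rfl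
  have h (a b : R ⧸ (⊤ : Ideal R)) : renewalMatrix c (pushWeight (coset ⊤) v) a b = 1 := by
    rw [← renewalMatrix_row_sum c ((sum_pushWeight (coset (⊤ : Ideal R)) v).trans hv1) a]
    exact (Fintype.sum_subsingleton _ b).symm
  simp [cosetEntropy, matrixEntropy, h]

/-- A union bound term of the random code: `K` symbols per block suffice against the words that
differ by elements of `I` from the true one. -/
theorem div_card_pow_le {n : ℕ} {K : ℕ} {r i ρ a δ : ℝ} (hr : 0 < r) (hi : 1 ≤ i)
    (hρ : 1 < ρ) (hiρ : i ≤ ρ) (hK : (n + 1) * r / Real.logb 2 ρ < K + 1)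
    (ha : a + 3 * δ ≤ r * Real.logb 2 i / Real.logb 2 ρ) :
    (2 : ℝ) ^ (n * (a + 2 * δ)) / i ^ K ≤ ρ * (2 : ℝ) ^ (-(n * δ)) := by
  have hi0 : 0 < i := by linarith
  have hl : 0 ≤ Real.logb 2 i := Real.logb_nonneg one_lt_two hi
  have hρl : 0 < Real.logb 2 ρ := Real.logb_pos one_lt_two hρ
  have hpow : i ^ K = (2 : ℝ) ^ (K * Real.logb 2 i) := by
    rw [mul_comm, Real.rpow_mul zero_le_two, Real.rpow_logb two_pos (by norm_num) hi0,
      Real.rpow_natCast]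
  have hexp : n * (a + 2 * δ) - K * Real.logb 2 i ≤ Real.logb 2 i + -(n * δ) := by
    have h1 : (n + 1) * r / Real.logb 2 ρ * Real.logb 2 i ≤ (K + 1) * Real.logb 2 i :=
      mul_le_mul_of_nonneg_right hK.le hl
    have h2 : (n : ℝ) * (a + 3 * δ) ≤ n * (r * Real.logb 2 i / Real.logb 2 ρ) :=
      mul_le_mul_of_nonneg_left ha (Nat.cast_nonneg n)
    have h3 : 0 ≤ r * Real.logb 2 i / Real.logb 2 ρ := by positivity
    have h4 : (n + 1) * r / Real.logb 2 ρ * Real.logb 2 i =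
        n * (r * Real.logb 2 i / Real.logb 2 ρ) + r * Real.logb 2 i / Real.logb 2 ρ := by ring
    linarith
  rw [hpow, ← Real.rpow_sub two_pos]
  calc (2 : ℝ) ^ (n * (a + 2 * δ) - K * Real.logb 2 i)
      ≤ (2 : ℝ) ^ (Real.logb 2 i + -(n * δ)) :=
        Real.rpow_le_rpow_of_exponent_le one_le_two hexp
    _ = i * (2 : ℝ) ^ (-(n * δ)) := by
        rw [Real.rpow_add two_pos, Real.rpow_logb two_pos (by norm_num) hi0]
    _ ≤ _ := by gcongr

/-- Linear coding over `R` computes `g` at every rate exceeding, for each nonzero left ideal `I`,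
the normalised entropy rate of the sum process given its cosets modulo `I`. -/
theorem const_mem_codingRegion {X : ℕ → Ω → (∀ t, 𝒳 t)} {g : (∀ t, 𝒳 t) → 𝒴}
    {R : Type*} [Ring R] [Fintype R] [Nontrivial R] {k : ∀ t, 𝒳 t → R} {h : R → 𝒴}
    (hg : IsPresentation g k h) {c : ℝ} {v : sumRange k → ℝ} (hc : 0 < c) (hc1 : c ≤ 1)
    (hv : ∀ z, 0 < v z) (hv1 : ∑ z, v z = 1)
    (hZ : IsMarkovChain μ (sumProcess k X) (renewalMatrix c v)) {r : ℝ} (hr : 0 < r)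
    (hrI : ∀ I : Ideal R, I ≠ ⊥ → Real.logb 2 (Nat.card R) / Real.logb 2 (Nat.card I) *
      (matrixEntropy (renewalMatrix c v) v - cosetEntropy c v I) < r) :
    (fun _ => r) ∈ codingRegion μ X g := by
  classical
  have : Fintype {I : Ideal R // I ≠ ⊥} := Fintype.ofFinite _
  set P := renewalMatrix c v with hP
  set H := matrixEntropy P v with hH
  set Z := sumProcess k X with hZdef
  have hPpos (a b : sumRange k) : 0 < P a b := renewalMatrix_pos hc hc1 a (hv b)
  have hR1 : (1 : ℝ) < Nat.card R := by
    rw [Nat.card_eq_fintype_card]; exact_mod_cast Fintype.one_lt_card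
  have hRl : 0 < Real.logb 2 (Nat.card R) := Real.logb_pos one_lt_two hR1
  have hI1 (I : {I : Ideal R // I ≠ ⊥}) : (1 : ℝ) < Nat.card I.1 := by
    have : Nontrivial I.1 := Submodule.nontrivial_iff_ne_bot.2 I.2
    exact_mod_cast Finite.one_lt_card
  have hIR (I : {I : Ideal R // I ≠ ⊥}) : (Nat.card I.1 : ℝ) ≤ Nat.card R := by
    exact_mod_cast Nat.card_le_card_of_injective _ (Subtype.val_injective (p := (· ∈ I.1)))
  -- the slack left by `r`, uniformly in the finitely many ideals
  obtain ⟨δ, hδI, hδ⟩ : ∃ δ : ℝ, (∀ I : {I : Ideal R // I ≠ ⊥}, H - cosetEntropy c v I.1 + 3 * δ <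
      r * Real.logb 2 (Nat.card I.1) / Real.logb 2 (Nat.card R)) ∧ 0 < δ := by
    have h1 : ∀ᶠ δ : ℝ in 𝓝[>] 0, ∀ I : {I : Ideal R // I ≠ ⊥}, H - cosetEntropy c v I.1 + 3 * δ <
        r * Real.logb 2 (Nat.card I.1) / Real.logb 2 (Nat.card R) := by
      rw [eventually_all]
      intro I
      have hIl := Real.logb_pos one_lt_two (hI1 I)
      have h2 : H - cosetEntropy c v I.1 + 3 * 0 <
          r * Real.logb 2 (Nat.card I.1) / Real.logb 2 (Nat.card R) := by
        have := hrI I.1 I.2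
        rw [div_mul_eq_mul_div, div_lt_iff₀ hIl] at this
        rw [lt_div_iff₀ hRl]
        linarith
      have h3 : Continuous fun δ : ℝ => H - cosetEntropy c v I.1 + 3 * δ := by fun_prop
      exact (h3.continuousAt.eventually_lt_const h2).filter_mono nhdsWithin_le_nhds
    exact (h1.and self_mem_nhdsWithin).exists
  set f₀ : sumRange k → sumRange k → ℝ := fun a b => -Real.logb 2 (P a b) with hf₀
  set f : {I : Ideal R // I ≠ ⊥} → sumRange k → sumRange k → ℝ := fun I a b =>
    -Real.logb 2 (renewalMatrix c (pushWeight (coset I.1) v) (coset I.1 a) (coset I.1 b)) with hf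
  have hm₀ : transMean P v f₀ = H := (matrixEntropy_eq_transMean P v).symm
  have hm (I : {I : Ideal R // I ≠ ⊥}) : transMean P v (f I) = cosetEntropy c v I.1 :=
    (matrixEntropy_pushWeight (coset I.1) c v).symm
  -- the probability of an atypical block, and the union bound for the random code
  set bad₀ : ℕ → Set Ω := fun n =>
    {ω | n * δ ≤ |transSum f₀ n (fun i => Z i ω) - n * H|} with hbad₀
  set bad : {I : Ideal R // I ≠ ⊥} → ℕ → Set Ω := fun I n =>
    {ω | n * δ ≤ |transSum (f I) n (fun i => Z i ω) - n * cosetEntropy c v I.1|} with hbad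
  set E : ℕ → ℝ := fun n => μ.real (bad₀ n) + ∑ I, μ.real (bad I n) +
    ∑ _I : {I : Ideal R // I ≠ ⊥}, Fintype.card (sumRange k) *
      (Nat.card R * (2 : ℝ) ^ (-(n * δ))) with hE
  have hElim : Tendsto E atTop (𝓝 0) := by
    have h1 : Tendsto (fun n => μ.real (bad₀ n)) atTop (𝓝 0) := by
      have := hZ.tendsto_transSum hc hv1 f₀ hδ
      rwa [← hP, hm₀] at this
    have h2 (I : {I : Ideal R // I ≠ ⊥}) : Tendsto (fun n => μ.real (bad I n)) atTop (𝓝 0) := by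
      have := hZ.tendsto_transSum hc hv1 (f I) hδ
      rwa [← hP, hm] at this
    have h3 : Tendsto (fun n : ℕ => (2 : ℝ) ^ (-(n * δ))) atTop (𝓝 0) := by
      have e (n : ℕ) : (2 : ℝ) ^ (-(n * δ)) = ((2 : ℝ) ^ (-δ)) ^ n := by
        rw [← Real.rpow_natCast, ← Real.rpow_mul zero_le_two]
        ring_nf
      rw [funext e]
      exact tendsto_pow_atTop_nhds_zero_of_lt_one (by positivity)
        (Real.rpow_lt_one_of_one_lt_of_neg one_lt_two (by linarith))
    have h4 := (h1.add (tendsto_finsetSum Finset.univ fun I _ => h2 I)).add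
      (tendsto_finsetSum (Finset.univ : Finset {I : Ideal R // I ≠ ⊥}) fun I _ =>
        (h3.const_mul (Nat.card R : ℝ)).const_mul (Fintype.card (sumRange k) : ℝ))
    simp only [mul_zero, Finset.sum_const_zero, add_zero] at h4
    exact h4
  intro ε hε
  obtain ⟨N₀, hN₀⟩ := eventually_atTop.1 (hElim.eventually_lt_const hε)
  refine ⟨N₀, fun N hN => ?_⟩
  -- a block of `n + 1` symbols has `n` transitions
  obtain ⟨n, rfl⟩ : ∃ n, N = n + 1 := ⟨N - 1, by omega⟩
  set K := ⌊((n : ℝ) + 1) * r / Real.logb 2 (Nat.card R)⌋₊ with hKdef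
  have hK1 : ((n : ℝ) + 1) * r / Real.logb 2 (Nat.card R) < K + 1 := Nat.lt_floor_add_one _
  have hK : (Nat.card R : ℝ) ^ K ≤ (2 : ℝ) ^ (((n + 1 : ℕ) : ℝ) * r) := by
    have h1 : (K : ℝ) ≤ ((n : ℝ) + 1) * r / Real.logb 2 (Nat.card R) :=
      Nat.floor_le (by positivity)
    rw [le_div_iff₀ hRl] at h1
    calc (Nat.card R : ℝ) ^ K = (2 : ℝ) ^ (K * Real.logb 2 (Nat.card R)) := by
          rw [mul_comm, Real.rpow_mul zero_le_two, Real.rpow_logb two_pos (by norm_num)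
            (by linarith), Real.rpow_natCast]
      _ ≤ _ := Real.rpow_le_rpow_of_exponent_le one_le_two (by push_cast; exact h1)
  set T : Finset (Fin (n + 1) → sumRange k) := Finset.univ.filter fun z =>
    |transSum f₀ n z - n * H| < n * δ ∧
      ∀ I, |transSum (f I) n z - n * cosetEntropy c v I.1| < n * δ with hT
  obtain ⟨A, hA⟩ := exists_matrix_error_le (Subtype.val_injective (p := (· ∈ sumRange k))) K
    (pathLaw μ Z (n + 1)) (pathLaw_nonneg _ _) (sum_pathLaw hZ.measurable _).le T
    (fun I => Fintype.card (sumRange k) * (2 : ℝ) ^ (n * (H - cosetEntropy c v I.1 + 2 * δ)))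
    (fun I => by positivity) (fun I z hz => by
      have hzT := (Finset.mem_filter.1 hz).2
      have := card_typical_fiber_le (f := coset I.1) (H := H) (L := cosetEntropy c v I.1)
        (δ := δ) hPpos
        (renewalMatrix_nonneg hc.le hc1 (pushWeight_nonneg (coset I.1) fun i => (hv i).le))
        (fun a b => renewalMatrix_pos hc hc1 _ (pushWeight_pos (coset I.1) hv b))
        (sum_renewalMatrix_fiber (coset I.1) c v) T
        (fun x hx => by
          have := (abs_lt.1 (Finset.mem_filter.1 hx).2.1).2
          linarith) z
        (by
          have := (abs_lt.1 (hzT.2 I)).1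
          linarith)
      simpa only [coset, Submodule.Quotient.eq] using this)
  obtain ⟨φ, ψ, hφψ⟩ := exists_code (r := r) hg hK A T
  refine ⟨φ, ψ, lt_of_le_of_lt ?_ (hN₀ n (by omega))⟩
  set conf : (Fin (n + 1) → sumRange k) → Prop := IsConfused Subtype.val A T
  have hsub : {ω | (fun i : Fin (n + 1) => g (X i ω)) ≠
      ψ fun t => φ t fun i => X i ω t} ⊆
      (bad₀ n ∪ ⋃ I ∈ (Finset.univ : Finset {I : Ideal R // I ≠ ⊥}), bad I n) ∪
        {ω | conf fun i => Z i ω} := by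
    intro ω hω
    by_contra hcon
    simp only [Set.mem_union, not_or, Set.mem_iUnion, Finset.mem_univ, exists_prop, true_and,
      not_exists] at hcon
    obtain ⟨⟨h1, h2⟩, h3⟩ := hcon
    have hzT : (fun i : Fin (n + 1) => Z i ω) ∈ T :=
      Finset.mem_filter.2 ⟨Finset.mem_univ _, not_le.1 h1, fun I => not_le.1 (h2 I)⟩
    refine hω (hφψ (fun i => X i ω) _ hzT (fun i => rfl) fun z' hz' he => ?_)
    by_contra hne
    exact h3 ⟨hzT, z', hz', hne, he⟩
  have hconfle : μ.real {ω | conf fun i => Z i ω} ≤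
      ∑ _I : {I : Ideal R // I ≠ ⊥}, Fintype.card (sumRange k) *
        (Nat.card R * (2 : ℝ) ^ (-(n * δ))) := by
    rw [measureReal_path hZ.measurable (n + 1) conf]
    refine hA.trans (Finset.sum_le_sum fun I _ => ?_)
    rw [mul_div_assoc]
    exact mul_le_mul_of_nonneg_left
      (div_card_pow_le hr (hI1 I).le hR1 (hIR I) hK1 (hδI I).le) (Nat.cast_nonneg _)
  calc _ ≤ μ.real ((bad₀ n ∪ ⋃ I ∈ (Finset.univ : Finset {I : Ideal R // I ≠ ⊥}), bad I n) ∪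
        {ω | conf fun i => Z i ω}) := measureReal_mono hsub
    _ ≤ μ.real (bad₀ n ∪ ⋃ I ∈ (Finset.univ : Finset {I : Ideal R // I ≠ ⊥}), bad I n) +
        μ.real {ω | conf fun i => Z i ω} := measureReal_union_le _ _
    _ ≤ μ.real (bad₀ n) + ∑ I, μ.real (bad I n) + μ.real {ω | conf fun i => Z i ω} := by
        gcongr
        refine (measureReal_union_le _ _).trans ?_
        gcongr
        exact measureReal_biUnion_finset_le _ _
    _ ≤ E n := by
        exact add_le_add le_rfl hconfle

end Achievability

/-! ### Presentations -/

section Presentation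

/-- Every function on a finite product is presented over a finite ring by a sum that determines
its arguments: the `t`-th argument is recorded in the `t`-th factor of a power of `ZMod N`. -/
theorem exists_presentation {s : ℕ} {𝒳 : Fin s → Type*} [∀ t, Fintype (𝒳 t)] {𝒴 : Type*}
    [Nonempty (∀ t, 𝒳 t)] (g : (∀ t, 𝒳 t) → 𝒴) :
    ∃ (R : Type) (_ : Ring R) (_ : Fintype R) (_ : Nontrivial R) (k : ∀ t, 𝒳 t → R) (h : R → 𝒴),
      IsPresentation g k h := by
  classical
  -- `N` exceeds `1` and every alphabet size; the extra factor keeps the ring nontrivial for `s = 0`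
  set N := 2 + ∑ t, Fintype.card (𝒳 t) with hN
  have : Fact (1 < N) := ⟨by omega⟩
  have : NeZero N := ⟨by omega⟩
  let k : ∀ t, 𝒳 t → (Fin (s + 1) → ZMod N) := fun t x =>
    Pi.single t.castSucc ((Fintype.equivFin (𝒳 t) x : ℕ) : ZMod N)
  have hinj : Function.Injective fun x : (∀ t, 𝒳 t) => ∑ t, k t (x t) := by
    intro x y hxy
    funext t
    have hcoord (x : ∀ t, 𝒳 t) : (∑ t, k t (x t)) t.castSucc =
        ((Fintype.equivFin (𝒳 t) (x t) : ℕ) : ZMod N) := by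
      rw [Finset.sum_apply, Finset.sum_eq_single t]
      · simp [k]
      · intro t' _ ht'
        simp [k, ht'.symm]
      · simp
    have h1 := (hcoord x).symm.trans ((congrFun hxy t.castSucc).trans (hcoord y))
    have hlt (z : 𝒳 t) : (Fintype.equivFin (𝒳 t) z : ℕ) < N := by
      have h2 := Finset.single_le_sum (f := fun t => Fintype.card (𝒳 t)) (fun _ _ => Nat.zero_le _)
        (Finset.mem_univ t)
      have h3 := (Fintype.equivFin (𝒳 t) z).2
      omega
    have h4 := congrArg ZMod.val h1
    rw [ZMod.val_natCast_of_lt (hlt _), ZMod.val_natCast_of_lt (hlt _)] at h4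
    exact (Fintype.equivFin (𝒳 t)).injective (Fin.ext h4)
  refine ⟨Fin (s + 1) → ZMod N, inferInstance, inferInstance, inferInstance, k,
    fun z => g (Function.invFun (fun x : (∀ t, 𝒳 t) => ∑ t, k t (x t)) z), fun x => ?_⟩
  exact congrArg g (Function.leftInverse_invFun hinj x).symm

/-- The sum process of a renewal chain is a renewal chain with positive weights. -/
theorem exists_isMarkovChain_sumProcess {Ω : Type*} [MeasurableSpace Ω] {μ : Measure Ω}
    [IsProbabilityMeasure μ] {s : ℕ} {𝒳 : Fin s → Type*} [∀ t, Fintype (𝒳 t)]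
    {X : ℕ → Ω → (∀ t, 𝒳 t)} {c : ℝ} {u : (∀ t, 𝒳 t) → ℝ} (hc : 0 ≤ c) (hc1 : c ≤ 1)
    (hu : ∀ x, 0 < u x) (hu1 : ∑ x, u x = 1) (hX : IsMarkovChain μ X (renewalMatrix c u))
    {R : Type*} [Ring R] [Fintype R] (k : ∀ t, 𝒳 t → R) :
    ∃ v : sumRange k → ℝ, (∀ z, 0 < v z) ∧ ∑ z, v z = 1 ∧
      IsMarkovChain μ (sumProcess k X) (renewalMatrix c v) := by
  let F : (∀ t, 𝒳 t) → sumRange k := fun x => ⟨∑ t, k t (x t), x, rfl⟩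
  refine ⟨pushWeight F u, ?_, (sum_pushWeight F u).trans hu1,
    hX.lump_renewalMatrix hc hc1 (fun x => (hu x).le) hu1 F⟩
  rintro ⟨_, x, rfl⟩
  exact pushWeight_pos F hu x

end Presentation

end MarkovCoding

theorem mainTheorem4 {Ω : Type*} [MeasurableSpace Ω] (μ : Measure Ω) [IsProbabilityMeasure μ]
    {s : ℕ} {𝒳 : Fin s → Type*} [∀ t, Fintype (𝒳 t)] [∀ t, DecidableEq (𝒳 t)] {𝒴 : Type*}
    (g : (∀ t, 𝒳 t) → 𝒴) (X : ℕ → Ω → (∀ t, 𝒳 t))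
    (c₁ : ℝ) (hc₀ : 0 ≤ c₁) (hc₁ : c₁ ≤ 1)
    (u : (∀ t, 𝒳 t) → ℝ) (hu₁ : ∑ x, u x = 1)
    (hX : MarkovCoding.IsIrreducibleMarkovChain μ X
      (c₁ • Matrix.of (fun _ y => u y) + (1 - c₁) • (1 : Matrix (∀ t, 𝒳 t) (∀ t, 𝒳 t) ℝ))) :
    (∃ (R : Type) (_ : Ring R) (_ : Fintype R) (_ : Nontrivial R)
      (k : ∀ t, 𝒳 t → R) (h : R → 𝒴)
      (P : Matrix (MarkovCoding.sumRange k) (MarkovCoding.sumRange k) ℝ)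
      (π : MarkovCoding.sumRange k → ℝ),
        MarkovCoding.IsPresentation g k h ∧
        MarkovCoding.IsIrreducibleMarkovChain μ (MarkovCoding.sumProcess k X) P ∧
        MarkovCoding.IsInvariantDistribution π P) ∧
    ∀ (R : Type*) [Ring R] [Fintype R] [Nontrivial R] (k : ∀ t, 𝒳 t → R) (h : R → 𝒴)
      (P : Matrix (MarkovCoding.sumRange k) (MarkovCoding.sumRange k) ℝ)
      (π : MarkovCoding.sumRange k → ℝ),
      MarkovCoding.IsPresentation g k h →
      MarkovCoding.IsIrreducibleMarkovChain μ (MarkovCoding.sumProcess k X) P →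
      MarkovCoding.IsInvariantDistribution π P →
      ∃ L : Ideal R → ℝ,
        (∀ I : Ideal R, I ≠ ⊥ →
          Tendsto (fun m : ℕ => MarkovCoding.condEntropy μ
              (fun ω => MarkovCoding.coset I (MarkovCoding.sumProcess k X (m + 1) ω))
              (fun ω => MarkovCoding.coset I (MarkovCoding.sumProcess k X m ω)))
            atTop (𝓝 (L I))) ∧
        {r : Fin s → ℝ | ∃ r₀ : ℝ, r₀ > MarkovCoding.rateBound P π L ∧ r = fun _ => r₀} ⊆
          MarkovCoding.codingRegion μ X g := by
  obtain ⟨c, hc, hc1, hu, hP₀⟩ :=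
    MarkovCoding.exists_eq_renewalMatrix hc₀ hc₁ hu₁ hX.2
  have hX' := hP₀ ▸ hX.1
  constructor
  · obtain ⟨ω⟩ : Nonempty Ω := nonempty_of_isProbabilityMeasure μ
    have : Nonempty (∀ t, 𝒳 t) := ⟨X 0 ω⟩
    obtain ⟨R, hR, hR', hR'', k, h, hg⟩ := MarkovCoding.exists_presentation g
    obtain ⟨v, hv, hv1, hZ⟩ :=
      MarkovCoding.exists_isMarkovChain_sumProcess hc.le hc1 hu hu₁ hX' k
    exact ⟨R, hR, hR', hR'', k, h, _, v, hg,
      ⟨hZ, MarkovCoding.isIrreducible_of_pos fun i j =>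
        MarkovCoding.renewalMatrix_pos hc hc1 i (hv j)⟩,
      MarkovCoding.isInvariantDistribution_renewalMatrix (fun z => (hv z).le) hv1⟩
  · intro R _ _ _ k h P π hg hZP hπ
    obtain ⟨v, hv, hv1, hZ⟩ :=
      MarkovCoding.exists_isMarkovChain_sumProcess hc.le hc1 hu hu₁ hX' k
    obtain rfl := hZ.eq_of_pos hZP.1 fun i j => MarkovCoding.renewalMatrix_pos hc hc1 i (hv j)
    obtain rfl := hπ.eq_weight hc
    refine ⟨MarkovCoding.cosetEntropy c π, fun I _ => ?_, ?_⟩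
    · exact (hZ.lump_renewalMatrix hc.le hc1 (fun z => (hv z).le) hv1
        (MarkovCoding.coset I)).tendsto_condEntropy hc hc1
    · rintro _ ⟨r, hr, rfl⟩
      have hrI (I : Ideal R) (hI : I ≠ ⊥) :
          Real.logb 2 (Nat.card R) / Real.logb 2 (Nat.card I) *
            (MarkovCoding.matrixEntropy (MarkovCoding.renewalMatrix c π) π -
              MarkovCoding.cosetEntropy c π I) < r := by
        refine lt_of_le_of_lt ?_ hr
        -- the minimum in the rate bound is always attained by its second term
        have hmin : MarkovCoding.matrixEntropy (MarkovCoding.renewalMatrix c π) π -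
            MarkovCoding.cosetEntropy c π I ≤ MarkovCoding.matrixEntropy
              (MarkovCoding.diagComplement (MarkovCoding.renewalMatrix c π)
                (MarkovCoding.coset I)) π :=
          MarkovCoding.matrixEntropy_sub_le_diagComplement hc hc1 hv hv1 (MarkovCoding.coset I)
        rw [← min_eq_right hmin]
        exact le_ciSup (f := fun I : {I : Ideal R // I ≠ ⊥} =>
          Real.logb 2 (Nat.card R) / Real.logb 2 (Nat.card I.1) *
            min (MarkovCoding.matrixEntropy (MarkovCoding.diagComplement
              (MarkovCoding.renewalMatrix c π) (MarkovCoding.coset I.1)) π)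
              (MarkovCoding.matrixEntropy (MarkovCoding.renewalMatrix c π) π -
                MarkovCoding.cosetEntropy c π I.1))
          (Set.finite_range _).bddAbove ⟨I, hI⟩
      -- the left ideal `R` itself shows that the rate is positive, so that messages exist
      have hr0 : 0 < r := by
        refine lt_of_le_of_lt ?_ (hrI ⊤ top_ne_bot)
        rw [MarkovCoding.cosetEntropy_top c hv1, sub_zero]
        exact mul_nonneg (div_nonneg (Real.logb_nonneg one_lt_two (by exact_mod_cast Nat.card_pos))
          (Real.logb_nonneg one_lt_two (by exact_mod_cast Nat.card_pos)))
          (MarkovCoding.matrixEntropy_nonneg hZ.nonneg hZ.row_sum fun z => (hv z).le)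
      exact MarkovCoding.const_mem_codingRegion hg hc hc1 hv hv1 hZ hr0 hrI
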